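/- Let $k_1,\dots,k_5>0$ and $\gamma\in\mathbb{R}\setminus\{0\}$, and consider on $\mathbb{R}$ the thermoelastic laminated Timoshenko system of type III with the thermal coupling on the transversal displacement, $$\begin{cases}\varphi_{tt}-k_1(\varphi_x+\psi+w)_x+\gamma q_{xt}=0,\\ \psi_{tt}-k_2\psi_{xx}+k_1(\varphi_x+\psi+w)=0,\\ w_{tt}-k_3w_{xx}+k_1(\varphi_x+\psi+w)=0,\\ q_{tt}-k_4q_{xx}+D q_t+\gamma\varphi_{xt}=0,\end{cases}$$ in two cases: case (A), $D q_t=-k_5q_{xxt}$, with $\epsilon_0:=1$; and case (B), $D q_t=k_5q_t$, with $\epsilon_0:=0$. In the variables $U=(v,u,z,y,\phi,\theta,\sigma,\eta)^T=(\varphi_x+\psi+w,\ \varphi_t,\ \psi_x,\ \psi_t,\ w_x,\ w_t,\ q_x,\ q_t)^T$ it is written as the first-order Cauchy problem $$U_t+A_2U_{xx}+A_1U_x+A_0U=0,\qquad U(\cdot,0)=U_0,\qquad(1)$$ where $A_2U_{xx}=(0,0,0,0,0,0,0,-\epsilon_0k_5\eta_{xx})^T$, $A_1U_x=(-u_x,\,-k_1v_x+\gamma\eta_x,\,-y_x,\,-k_2z_x,\,-\theta_x,\,-k_3\phi_x,\,-\eta_x,\,-k_4\sigma_x+\gamma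 u_x)^T$ and $A_0U=(-y-\theta,\,0,\,0,\,k_1v,\,0,\,k_1v,\,0,\,(1-\epsilon_0)k_5\eta)^T$. A solution of (1) is a function $U\in C([0,\infty);L^2(\mathbb{R};\mathbb{C}^8))$ with $U(0)=U_0$ that satisfies the equation for every $t>0$ in the sense of tempered distributions in $x$: $t\mapsto\langle U(t),g\rangle$ is differentiable on $(0,\infty)$ for every Schwartz function $g$, with derivative $-\langle A_2U_{xx}+A_1U_x+A_0U,g\rangle$. Derivatives $\partial_x^j$ are taken in the sense of distributions. Assume $\chi:=k_3-k_2\neq0$. Then the following hold. (i) Put $f(\xi)=\dfrac{\xi^{6}}{1+\xi^2+\xi^4+\xi^6+\xi^8}$ in case (A) and $f(\xi)=\dfrac{\xi^{4}}{1+\xi^2+\xi^4+\xi^6}$ in case (B). In each case there are $c,\tilde c>0$, depending only on $k_1,\dots,k_5,\gamma$, such that for every $\xi\in\mathbb{R}$ every solution $\widehat U(\xi,\cdot)$ on $[0,\infty)$ of the system in Fourier space, $\widehat U_t-\xi^2A_2\widehat U+i\xi A_1\widehat U+A_0\widehat U=0$, satisfies $$|\widehat U(\xi,t)|^2\le\tilde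 c\,e^{-c f(\xi)t}\,|\widehat U(\xi,0)|^2\qquad\text{for all }t\ge0.$$ (ii) Let $N,\ell\ge1$ be integers with $\ell\le N$, and let $j\in\{0,\dots,N-\ell\}$. There is $c_0>0$, depending only on $k_1,\dots,k_5,\gamma,N,\ell,j$, such that for every $U_0\in H^N(\mathbb{R};\mathbb{C}^8)\cap L^1(\mathbb{R};\mathbb{C}^8)$, every solution $U$ of (1) and every $t\ge0$, $\partial_x^jU(t)$ and $\partial_x^{j+\ell}U_0$ belong to $L^2$ and, in case (A), $$\|\partial_x^jU(t)\|_{L^2}\le c_0(1+t)^{-1/12-j/6}\|U_0\|_{L^1}+c_0(1+t)^{-\ell/2}\|\partial_x^{j+\ell}U_0\|_{L^2},$$ while in case (B) $$\|\partial_x^jU(t)\|_{L^2}\le c_0(1+t)^{-1/8-j/4}\|U_0\|_{L^1}+c_0(1+t)^{-\ell/2}\|\partial_x^{j+\ell}U_0\|_{L^2}.$$ -/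

import Mathlib

open MeasureTheory Set
open scoped SchwartzMap

noncomputable section

namespace LaminatedBeam

/-- The two heat conduction laws: `strong` has the dissipative term `-k₅ q_{xxt}`,
`weak` has the lower order dissipative term `k₅ q_t`. -/
inductive HeatDissipation
  | strong
  | weak

/-- The switch `ε₀`: it is `1` for the dissipation `-k₅ q_{xxt}` and `0` for `k₅ q_t`. -/
def HeatDissipation.eps : HeatDissipation → ℕ
  | .strong => 1
  | .weak => 0

/-- The coefficients of the system: `k₁, …, k₅`, the coupling constant `γ` and the
location `(τ₁, τ₂, τ₃)` of the thermal coupling. -/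
structure Coefficients where
  k₁ : ℝ
  k₂ : ℝ
  k₃ : ℝ
  k₄ : ℝ
  k₅ : ℝ
  γ : ℝ
  τ₁ : ℝ
  τ₂ : ℝ
  τ₃ : ℝ

/-- State vectors `(v, u, z, y, φ, θ, σ, η)`, with the Hermitian norm of `ℂ⁸`. -/
abbrev State : Type := EuclideanSpace ℂ (Fin 8)

/-- The state space `L²(ℝ; ℂ⁸)`. -/
abbrev StateL2 : Type := Lp State 2 (volume : Measure ℝ)

/-- The matrix `A₂`: the only nonzero component of `A₂ U_xx` is the last one,
`-ε₀ k₅ η_xx`. -/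
def matA₂ (p : Coefficients) (d : HeatDissipation) : Matrix (Fin 8) (Fin 8) ℝ :=
  Matrix.single 7 7 (-((d.eps : ℝ) * p.k₅))

/-- The matrix `A₁` (rows and columns ordered as `v, u, z, y, φ, θ, σ, η`). -/
def matA₁ (p : Coefficients) : Matrix (Fin 8) (Fin 8) ℝ :=
  !![0,     -1,         0,     0,          0,     0,          0,     0;
     -p.k₁, 0,          0,     0,          0,     0,          0,     p.τ₁ * p.γ;
     0,     0,          0,     -1,         0,     0,          0,     0;
     0,     0,          -p.k₂, 0,          0,     0,          0,     p.τ₂ * p.γ;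
     0,     0,          0,     0,          0,     -1,         0,     0;
     0,     0,          0,     0,          -p.k₃, 0,          0,     p.τ₃ * p.γ;
     0,     0,          0,     0,          0,     0,          0,     -1;
     0,     p.γ * p.τ₁, 0,     p.γ * p.τ₂, 0,     p.γ * p.τ₃, -p.k₄, 0]

/-- The matrix `A₀` (rows and columns ordered as `v, u, z, y, φ, θ, σ, η`). -/
def matA₀ (p : Coefficients) (d : HeatDissipation) : Matrix (Fin 8) (Fin 8) ℝ :=
  !![0,    0, 0, -1, 0, -1, 0, 0;
     0,    0, 0, 0,  0, 0,  0, 0;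
     0,    0, 0, 0,  0, 0,  0, 0;
     p.k₁, 0, 0, 0,  0, 0,  0, 0;
     0,    0, 0, 0,  0, 0,  0, 0;
     p.k₁, 0, 0, 0,  0, 0,  0, 0;
     0,    0, 0, 0,  0, 0,  0, 0;
     0,    0, 0, 0,  0, 0,  0, (1 - (d.eps : ℝ)) * p.k₅]

/-- A real `8 × 8` matrix acting on `ℂ⁸`. -/
def act (A : Matrix (Fin 8) (Fin 8) ℝ) : State →L[ℂ] State :=
  Matrix.toEuclideanCLM (n := Fin 8) (𝕜 := ℂ) (A.map Complex.ofReal)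

/-- `g = ∂ₓʲ f` in the sense of (tempered) distributions, for `f, g ∈ L²(ℝ; ℂ⁸)`. -/
def IsXDeriv (j : ℕ) (f g : StateL2) : Prop :=
  (TemperedDistribution.derivCLM State)^[j] (f : 𝓢'(ℝ, State)) = (g : 𝓢'(ℝ, State))

/-- `U` is a (weak) solution on `[0, ∞)` of the Cauchy problem
`U_t + A₂ U_xx + A₁ U_x + A₀ U = 0`, `U(0) = U₀`: it is continuous on `[0, ∞)` with values in
`L²(ℝ; ℂ⁸)`, has the initial value `U₀`, and satisfies the equation for `t > 0` in the sense of
tempered distributions in `x`. -/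
structure IsSolution (p : Coefficients) (d : HeatDissipation) (U₀ : StateL2)
    (U : ℝ → StateL2) : Prop where
  continuousOn : ContinuousOn U (Ici 0)
  initial : U 0 = U₀
  equation : ∀ g : 𝓢(ℝ, ℂ), ∀ t : ℝ, 0 < t →
    HasDerivAt (fun s : ℝ => (U s : 𝓢'(ℝ, State)) g)
      (-(act (matA₂ p d) ((TemperedDistribution.derivCLM State)^[2] (U t : 𝓢'(ℝ, State)) g)
        + act (matA₁ p) (TemperedDistribution.derivCLM State (U t : 𝓢'(ℝ, State)) g)
        + act (matA₀ p d) ((U t : 𝓢'(ℝ, State)) g))) t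

/-- `V = Û(ξ, ·)` is a solution on `[0, ∞)` of the system in Fourier space at the frequency `ξ`,
`V' - ξ² A₂ V + i ξ A₁ V + A₀ V = 0`. -/
structure IsFourierSolution (p : Coefficients) (d : HeatDissipation) (ξ : ℝ)
    (V : ℝ → State) : Prop where
  continuousOn : ContinuousOn V (Ici 0)
  equation : ∀ t : ℝ, 0 < t →
    HasDerivAt V
      (-(-((ξ : ℂ) ^ 2 • act (matA₂ p d) (V t))
        + (Complex.I * (ξ : ℂ)) • act (matA₁ p) (V t)
        + act (matA₀ p d) (V t))) t

/-- The rational weight `f(ξ)`: `ξ⁶ / (1 + ξ² + ξ⁴ + ξ⁶ + ξ⁸)` for the dissipation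
`-k₅ q_{xxt}` and `ξ⁴ / (1 + ξ² + ξ⁴ + ξ⁶)` for the dissipation `k₅ q_t`. -/
def weight : HeatDissipation → ℝ → ℝ
  | .strong, ξ => ξ ^ 6 / (1 + ξ ^ 2 + ξ ^ 4 + ξ ^ 6 + ξ ^ 8)
  | .weak, ξ => ξ ^ 4 / (1 + ξ ^ 2 + ξ ^ 4 + ξ ^ 6)

/-- The coefficients `k₁, …, k₅, γ` with `(τ₁, τ₂, τ₃) = (1, 0, 0)`: thermal coupling on the
transversal displacement. -/
def transversal (k₁ k₂ k₃ k₄ k₅ γ : ℝ) : Coefficients :=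
  { k₁ := k₁, k₂ := k₂, k₃ := k₃, k₄ := k₄, k₅ := k₅, γ := γ, τ₁ := 1, τ₂ := 0, τ₃ := 0 }

end LaminatedBeam

end

/-! At each frequency `ξ` the system is a linear ODE in `ℂ⁸` whose generator `symbol` is skew for
the energy pairing except for the damping of `η`. The energy is therefore nonincreasing, but only
`η` is damped directly, and the rate at which the other components feel this must be quantified in
`ξ`.

The core is the uniform resolvent bound `exists_resolvent_bound`: `iμ - symbol` is bounded below by
a constant times the weight, for all real `μ` and `ξ`. If it failed, there would be normalised
approximate eigenmodes with error `o(weight)`. The energy identity makes `η` small, and smallness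
then spreads through the equations: from `η` to `γ u - k₄ σ`, to `v`, to `iξu + y + θ`, to the two
beam pairs `(z, y)` and `(φ, θ)`, and finally to `u` and `σ`. Separating the two beams needs
different speeds, `k₂ ≠ k₃`; for equal speeds the motions with `z = -φ`, `y = -θ` and all else zero
are undamped. All components vanish in the limit, against the normalisation. An ultrafilter makes
every comparison of `μ`, `ξ` and `1` a genuine dichotomy, without subsequences.

A quantitative Gearhart–Prüss argument (`exists_half_time`, `exists_exp_decay`) turns the bound into
exponential decay with constants independent of `ξ`: cut off the trajectory in time, apply
Plancherel in time and the resolvent bound, then use monotonicity of the energy. This gives (i).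

For (ii), `IsSolution.fourier_ae` identifies the Fourier transform of any weak solution with the
exponential flow. Plancherel in `x` then splits into low frequencies, where the weight behaves like
`|ξ| ^ lowOrder d` and the `L¹` norm bounds the transform of the data, and high frequencies, where
it behaves like `ξ⁻²` and each power `(1 + t)⁻¹` in the squared norm costs one derivative. -/

noncomputable section

namespace LaminatedBeam

open Asymptotics Filter

/-! ### Approximate eigenmodes -/

/-- Sequences of approximate eigenmodes of the system in Fourier space: at the frequency `ξ n` the
bounded state `(v, u, z, y, φ, θ, σ, η) n` solves the resolvent equation with spectral parameter
`i μ n` up to the error `F n`; `δ` is the damping term of the last equation. -/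
structure ApproxMode (k₁ k₂ k₃ k₄ γ : ℂ) where
  μ : ℕ → ℂ
  ξ : ℕ → ℂ
  v : ℕ → ℂ
  u : ℕ → ℂ
  z : ℕ → ℂ
  y : ℕ → ℂ
  φ : ℕ → ℂ
  θ : ℕ → ℂ
  σ : ℕ → ℂ
  η : ℕ → ℂ
  δ : ℕ → ℂ
  F : Fin 8 → ℕ → ℂ
  l : Ultrafilter ℕ
  ξ_ne : ∀ n, ξ n ≠ 0
  eqv : ∀ n, Complex.I * μ n * v n = Complex.I * ξ n * u n + y n + θ n + F 0 n
  equ : ∀ n, Complex.I * μ n * u n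
    = Complex.I * ξ n * (k₁ * v n) - Complex.I * ξ n * (γ * η n) + F 1 n
  eqz : ∀ n, Complex.I * μ n * z n = Complex.I * ξ n * y n + F 2 n
  eqy : ∀ n, Complex.I * μ n * y n = Complex.I * ξ n * (k₂ * z n) - k₁ * v n + F 3 n
  eqφ : ∀ n, Complex.I * μ n * φ n = Complex.I * ξ n * θ n + F 4 n
  eqθ : ∀ n, Complex.I * μ n * θ n = Complex.I * ξ n * (k₃ * φ n) - k₁ * v n + F 5 n
  eqσ : ∀ n, Complex.I * μ n * σ n = Complex.I * ξ n * η n + F 6 n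
  eqη : ∀ n, Complex.I * μ n * η n
    = Complex.I * ξ n * (k₄ * σ n) - Complex.I * ξ n * (γ * u n) - δ n + F 7 n
  bv : v =O[l] fun _ => (1 : ℂ)
  bu : u =O[l] fun _ => (1 : ℂ)
  bz : z =O[l] fun _ => (1 : ℂ)
  bY : y =O[l] fun _ => (1 : ℂ)
  bφ : φ =O[l] fun _ => (1 : ℂ)
  bθ : θ =O[l] fun _ => (1 : ℂ)

/-- Along an ultrafilter two functions are always comparable. -/
theorem isBigO_or_isLittleO (l : Ultrafilter ℕ) (f g : ℕ → ℂ) :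
    f =O[(l : Filter ℕ)] g ∨ g =o[(l : Filter ℕ)] f := by
  by_cases h : g =o[(l : Filter ℕ)] f
  · exact Or.inr h
  · left
    rw [isLittleO_iff] at h
    push Not at h
    obtain ⟨c, hc, h⟩ := h
    refine IsBigO.of_bound c⁻¹ (h.mono fun n hn => ?_)
    rw [inv_mul_eq_div, le_div_iff₀ hc, mul_comm]
    exact hn.le

theorem isLittleO_of_mul_left {l : Filter ℕ} {a f g : ℕ → ℂ} (ha : ∀ᶠ n in l, a n ≠ 0)
    (h : (fun n => a n * f n) =o[l] fun n => a n * g n) : f =o[l] g := by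
  rw [isLittleO_iff] at h ⊢
  intro c hc
  filter_upwards [h hc, ha] with n hn hna
  have : 0 < ‖a n‖ := norm_pos_iff.2 hna
  rw [norm_mul, norm_mul] at hn
  nlinarith

/-- Cancellation of a factor `I * a` with `a ≠ 0` in front of a small function. -/
theorem isLittleO_one_of_mul {l : Filter ℕ} {a f : ℕ → ℂ} (ha : ∀ᶠ n in l, a n ≠ 0)
    (h : (fun n => Complex.I * a n * f n) =o[l] a) : f =o[l] fun _ => (1 : ℂ) := by
  refine isLittleO_of_mul_left ha ?_
  have := h.const_mul_left (-Complex.I)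
  refine (this.congr_left fun n => ?_).congr_right fun n => ?_
  · linear_combination (-(a n * f n)) * Complex.I_sq
  · simp

namespace ApproxMode

variable {k₁ k₂ k₃ k₄ γ : ℂ} (S : ApproxMode k₁ k₂ k₃ k₄ γ)

/-- All components of the modes tend to zero. -/
def Vanishing : Prop :=
  S.v =o[(S.l : Filter ℕ)] (fun _ => (1 : ℂ)) ∧ S.u =o[(S.l : Filter ℕ)] (fun _ => (1 : ℂ)) ∧
  S.z =o[(S.l : Filter ℕ)] (fun _ => (1 : ℂ)) ∧ S.y =o[(S.l : Filter ℕ)] (fun _ => (1 : ℂ)) ∧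
  S.φ =o[(S.l : Filter ℕ)] (fun _ => (1 : ℂ)) ∧ S.θ =o[(S.l : Filter ℕ)] (fun _ => (1 : ℂ)) ∧
  S.σ =o[(S.l : Filter ℕ)] (fun _ => (1 : ℂ)) ∧ S.η =o[(S.l : Filter ℕ)] (fun _ => (1 : ℂ))

theorem eventually_ne {f : ℕ → ℂ} (h : S.ξ =o[(S.l : Filter ℕ)] f) :
    ∀ᶠ n in (S.l : Filter ℕ), f n ≠ 0 := by
  filter_upwards [isLittleO_iff.1 h one_pos] with n hn h0
  rw [h0, norm_zero, mul_zero] at hn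
  exact S.ξ_ne n (norm_le_zero_iff.1 hn)

/-- If `μ` dominates `ξ`, transport is negligible and each remaining equation reads `iμ f = o(μ)`.
The zero-order term `k₁ v` carries no factor `ξ`, so `v = o(μ)` is required separately: `μ` may
itself tend to zero. -/
theorem vanishing_of_isLittleO (h : S.ξ =o[(S.l : Filter ℕ)] S.μ)
    (hv : S.v =o[(S.l : Filter ℕ)] S.μ) (hv1 : S.v =o[(S.l : Filter ℕ)] fun _ => (1 : ℂ))
    (hη : S.η =o[(S.l : Filter ℕ)] fun _ => (1 : ℂ))
    (hF : ∀ i, S.F i =o[(S.l : Filter ℕ)] S.μ) : S.Vanishing := by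
  have hμ := S.eventually_ne h
  have key : ∀ (c : ℂ) (f : ℕ → ℂ), f =O[(S.l : Filter ℕ)] (fun _ => (1 : ℂ)) →
      (fun n => Complex.I * S.ξ n * (c * f n)) =o[(S.l : Filter ℕ)] S.μ := fun c f hf =>
    ((h.const_mul_left Complex.I).mul_isBigO (hf.const_mul_left c)).congr_right
      fun n => mul_one _
  have key1 : ∀ (f : ℕ → ℂ), f =O[(S.l : Filter ℕ)] (fun _ => (1 : ℂ)) →
      (fun n => Complex.I * S.ξ n * f n) =o[(S.l : Filter ℕ)] S.μ := fun f hf =>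
    (key 1 f hf).congr_left fun n => by ring
  refine ⟨hv1, ?_, ?_, ?_, ?_, ?_, ?_, hη⟩ <;> apply isLittleO_one_of_mul hμ
  · simp_rw [S.equ]
    exact ((key _ _ S.bv).sub (key _ _ hη.isBigO)).add (hF 1)
  · simp_rw [S.eqz]
    exact (key1 _ S.bY).add (hF 2)
  · simp_rw [S.eqy]
    exact ((key _ _ S.bz).sub (hv.const_mul_left _)).add (hF 3)
  · simp_rw [S.eqφ]
    exact (key1 _ S.bθ).add (hF 4)
  · simp_rw [S.eqθ]
    exact ((key _ _ S.bφ).sub (hv.const_mul_left _)).add (hF 5)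
  · simp_rw [S.eqσ]
    exact (key1 _ hη.isBigO).add (hF 6)

theorem vanishing_of_one_isLittleO (h : S.ξ =o[(S.l : Filter ℕ)] S.μ)
    (h1 : (fun _ => (1 : ℂ)) =o[(S.l : Filter ℕ)] S.μ)
    (hη : S.η =o[(S.l : Filter ℕ)] fun _ => (1 : ℂ))
    (hF : ∀ i, S.F i =o[(S.l : Filter ℕ)] fun _ => (1 : ℂ)) : S.Vanishing := by
  refine S.vanishing_of_isLittleO h (S.bv.trans_isLittleO h1) ?_ hη
    fun i => (hF i).trans h1
  apply isLittleO_one_of_mul (S.eventually_ne h)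
  simp_rw [S.eqv]
  refine (((((h.const_mul_left Complex.I).mul_isBigO S.bu).congr_right
    fun n => mul_one _).add ?_).add ?_).add ((hF 0).trans h1)
  · exact S.bY.trans_isLittleO h1
  · exact S.bθ.trans_isLittleO h1

/-- Adding the `y` and `θ` equations and `iξ` times the `u` equation puts `iμ(iξu + y + θ)` on the
left, which forces `k₂ z + k₃ φ` to vanish. Two further passes through the wave equations give `k₂ y
+ k₃ θ` and then `k₂² z + k₃² φ`. The system for `z` and `φ` has determinant `k₂ k₃ (k₃ - k₂)`, so
different speeds separate the beams. -/
theorem beams_vanish (hk₂ : k₂ ≠ 0) (hk₃ : k₃ ≠ 0) (hχ : k₃ - k₂ ≠ 0)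
    (h : S.μ =O[(S.l : Filter ℕ)] S.ξ)
    (hv : S.v =o[(S.l : Filter ℕ)] S.ξ)
    (hξv : (fun n => S.ξ n * S.v n) =o[(S.l : Filter ℕ)] fun _ => (1 : ℂ))
    (hξη : (fun n => S.ξ n * S.η n) =o[(S.l : Filter ℕ)] fun _ => (1 : ℂ))
    (hp : (fun n => Complex.I * S.ξ n * S.u n + S.y n + S.θ n)
      =o[(S.l : Filter ℕ)] fun _ => (1 : ℂ))
    (hF1 : S.F 1 =o[(S.l : Filter ℕ)] fun _ => (1 : ℂ))
    (hF : ∀ i, S.F i =o[(S.l : Filter ℕ)] S.ξ) :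
    S.z =o[(S.l : Filter ℕ)] (fun _ => (1 : ℂ)) ∧ S.y =o[(S.l : Filter ℕ)] (fun _ => (1 : ℂ)) ∧
    S.φ =o[(S.l : Filter ℕ)] (fun _ => (1 : ℂ)) ∧ S.θ =o[(S.l : Filter ℕ)] (fun _ => (1 : ℂ)) := by
  have hne : ∀ᶠ n in (S.l : Filter ℕ), S.ξ n ≠ 0 := Eventually.of_forall S.ξ_ne
  have hIμ : (fun n => Complex.I * S.μ n) =O[(S.l : Filter ℕ)] S.ξ := h.const_mul_left _
  have mμ : ∀ f : ℕ → ℂ, f =o[(S.l : Filter ℕ)] (fun _ => (1 : ℂ)) →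
      (fun n => Complex.I * S.μ n * f n) =o[(S.l : Filter ℕ)] S.ξ := fun f hf =>
    (hIμ.mul_isLittleO hf).congr_right fun n => mul_one _
  have mξ : ∀ (c : ℂ) (f : ℕ → ℂ), f =o[(S.l : Filter ℕ)] (fun _ => (1 : ℂ)) →
      (fun n => c * (S.ξ n * f n)) =o[(S.l : Filter ℕ)] S.ξ := fun c f hf =>
    (((isBigO_refl S.ξ _).mul_isLittleO hf).congr_right fun n => mul_one _).const_mul_left c
  have hq : (fun n => k₂ * S.z n + k₃ * S.φ n) =o[(S.l : Filter ℕ)] fun _ => (1 : ℂ) := by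
    apply isLittleO_one_of_mul hne
    have := ((((((mμ _ hp).add (mξ k₁ _ hξv)).sub (mξ γ _ hξη)).sub
      (mξ Complex.I _ hF1)).add (hv.const_mul_left (2 * k₁))).sub (hF 3)).sub (hF 5)
    refine this.congr_left fun n => ?_
    linear_combination (Complex.I * S.ξ n) * S.equ n + S.eqy n + S.eqθ n
      + (S.ξ n) ^ 2 * (k₁ * S.v n - γ * S.η n) * Complex.I_sq
  have hr : (fun n => k₂ * S.y n + k₃ * S.θ n) =o[(S.l : Filter ℕ)] fun _ => (1 : ℂ) := by
    apply isLittleO_one_of_mul hne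
    refine (((mμ _ hq).sub ((hF 2).const_mul_left k₂)).sub
      ((hF 4).const_mul_left k₃)).congr_left fun n => ?_
    linear_combination k₂ * S.eqz n + k₃ * S.eqφ n
  have hs : (fun n => k₂ ^ 2 * S.z n + k₃ ^ 2 * S.φ n)
      =o[(S.l : Filter ℕ)] fun _ => (1 : ℂ) := by
    apply isLittleO_one_of_mul hne
    refine ((((mμ _ hr).add (hv.const_mul_left ((k₂ + k₃) * k₁))).sub
      ((hF 3).const_mul_left k₂)).sub ((hF 5).const_mul_left k₃)).congr_left fun n => ?_
    linear_combination k₂ * S.eqy n + k₃ * S.eqθ n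
  have hφ : S.φ =o[(S.l : Filter ℕ)] fun _ => (1 : ℂ) := by
    refine ((hs.sub (hq.const_mul_left k₂)).const_mul_left (k₃ * (k₃ - k₂))⁻¹).congr_left
      fun n => ?_
    field_simp
    ring
  have hz : S.z =o[(S.l : Filter ℕ)] fun _ => (1 : ℂ) := by
    refine ((hq.sub (hφ.const_mul_left k₃)).const_mul_left k₂⁻¹).congr_left fun n => ?_
    field_simp
    ring
  refine ⟨hz, ?_, hφ, ?_⟩ <;> apply isLittleO_one_of_mul hne
  · exact ((mμ _ hz).sub (hF 2)).congr_left fun n => by linear_combination S.eqz n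
  · exact ((mμ _ hφ).sub (hF 4)).congr_left fun n => by linear_combination S.eqφ n

/-- `γ u - k₄ σ` is controlled by the last equation. -/
theorem eqw (n : ℕ) : Complex.I * S.ξ n * (γ * S.u n - k₄ * S.σ n)
    = -(Complex.I * S.μ n * S.η n) - S.δ n + S.F 7 n := by
  linear_combination S.eqη n

/-- The evolution of `γ u - k₄ σ` involves only `v` and `η`, so control of this combination and of
`η` transfers to `v`. -/
theorem eqw_time (n : ℕ) : γ * k₁ * (Complex.I * S.ξ n * S.v n)
    = Complex.I * S.μ n * (γ * S.u n - k₄ * S.σ n)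
      + (γ ^ 2 + k₄) * (Complex.I * S.ξ n * S.η n) - γ * S.F 1 n + k₄ * S.F 6 n := by
  linear_combination (-γ) * S.equ n + k₄ * S.eqσ n

/-- With `ξ` bounded below and `μ = O(ξ)`, a factor `μ` costs no more than a factor `ξ`. The whole
chain thus runs on quantities of the form `ξ f = o(1)`, starting from `ξ η`. -/
theorem vanishing_of_high (hk₁ : k₁ ≠ 0) (hk₂ : k₂ ≠ 0) (hk₃ : k₃ ≠ 0) (hk₄ : k₄ ≠ 0)
    (hγ : γ ≠ 0) (hχ : k₃ - k₂ ≠ 0)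
    (h1 : (fun _ => (1 : ℂ)) =O[(S.l : Filter ℕ)] S.ξ)
    (hη : (fun n => S.ξ n * S.η n) =o[(S.l : Filter ℕ)] fun _ => (1 : ℂ))
    (hδ : S.δ =o[(S.l : Filter ℕ)] fun _ => (1 : ℂ))
    (hF : ∀ i, S.F i =o[(S.l : Filter ℕ)] fun _ => (1 : ℂ)) :
    S.Vanishing := by
  have hne : ∀ᶠ n in (S.l : Filter ℕ), S.ξ n ≠ 0 := Eventually.of_forall S.ξ_ne
  have down : ∀ f : ℕ → ℂ, (fun n => S.ξ n * f n) =o[(S.l : Filter ℕ)] (fun _ => (1 : ℂ)) →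
      f =o[(S.l : Filter ℕ)] fun _ => (1 : ℂ) := fun f hf =>
    isLittleO_of_mul_left hne ((hf.trans_isBigO h1).congr_right fun n => (mul_one _).symm)
  have hη1 := down _ hη
  rcases isBigO_or_isLittleO S.l S.μ S.ξ with h | h
  swap
  · exact S.vanishing_of_one_isLittleO h (h1.trans_isLittleO h) hη1 hF
  have hw : (fun n => S.ξ n * (γ * S.u n - k₄ * S.σ n))
      =o[(S.l : Filter ℕ)] fun _ => (1 : ℂ) := by
    have hμη : (fun n => S.μ n * S.η n) =o[(S.l : Filter ℕ)] fun _ => (1 : ℂ) :=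
      (h.mul (isBigO_refl S.η _)).trans_isLittleO hη
    refine (((hμη.const_mul_left (-Complex.I)).sub hδ).add (hF 7)).const_mul_left
      (-Complex.I) |>.congr_left fun n => ?_
    linear_combination Complex.I * S.eqw n
      + (-(S.ξ n * (γ * S.u n - k₄ * S.σ n))) * Complex.I_sq
  have hμw : (fun n => S.μ n * (γ * S.u n - k₄ * S.σ n))
      =o[(S.l : Filter ℕ)] fun _ => (1 : ℂ) :=
    (h.mul (isBigO_refl _ _)).trans_isLittleO hw
  have hξv : (fun n => S.ξ n * S.v n) =o[(S.l : Filter ℕ)] fun _ => (1 : ℂ) := by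
    refine ((((hμw.const_mul_left Complex.I).add
      (hη.const_mul_left ((γ ^ 2 + k₄) * Complex.I))).sub ((hF 1).const_mul_left γ)).add
      ((hF 6).const_mul_left k₄)).const_mul_left (-Complex.I / (γ * k₁)) |>.congr_left
      fun n => ?_
    field_simp
    linear_combination Complex.I * S.eqw_time n + (-(γ * k₁ * S.ξ n * S.v n)) * Complex.I_sq
  have hv1 := down _ hξv
  have hp : (fun n => Complex.I * S.ξ n * S.u n + S.y n + S.θ n)
      =o[(S.l : Filter ℕ)] fun _ => (1 : ℂ) := by
    have hμv : (fun n => S.μ n * S.v n) =o[(S.l : Filter ℕ)] fun _ => (1 : ℂ) :=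
      (h.mul (isBigO_refl _ _)).trans_isLittleO hξv
    refine ((hμv.const_mul_left Complex.I).sub (hF 0)).congr_left fun n => ?_
    linear_combination S.eqv n
  obtain ⟨hz, hy, hφ, hθ⟩ := S.beams_vanish hk₂ hk₃ hχ h (hv1.trans_isBigO h1) hξv hη hp (hF 1)
    fun i => (hF i).trans_isBigO h1
  have hu : S.u =o[(S.l : Filter ℕ)] fun _ => (1 : ℂ) := by
    apply down
    refine ((hp.sub hy).sub hθ).const_mul_left (-Complex.I) |>.congr_left fun n => ?_
    linear_combination (-(S.ξ n * S.u n)) * Complex.I_sq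
  refine ⟨hv1, hu, hz, hy, hφ, hθ, ?_, hη1⟩
  refine ((hu.const_mul_left γ).sub (down _ hw)).const_mul_left k₄⁻¹ |>.congr_left fun n => ?_
  field_simp
  ring

/-- The same chain with powers of `ξ` counted: `η = o(ξ²)` gives `γ u - k₄ σ = o(ξ)`, then `v =
o(ξ)` and `iξu + y + θ = o(ξ²)` when `μ = O(ξ)`. The larger ranges of `μ` are settled by the
preceding lemmas. -/
theorem vanishing_of_low (hk₁ : k₁ ≠ 0) (hk₂ : k₂ ≠ 0) (hk₃ : k₃ ≠ 0) (hk₄ : k₄ ≠ 0)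
    (hγ : γ ≠ 0) (hχ : k₃ - k₂ ≠ 0)
    (h1 : S.ξ =O[(S.l : Filter ℕ)] fun _ => (1 : ℂ))
    (hη : S.η =o[(S.l : Filter ℕ)] fun n => S.ξ n ^ 2)
    (hδ : S.δ =o[(S.l : Filter ℕ)] fun n => S.ξ n ^ 2)
    (hF : ∀ i, S.F i =o[(S.l : Filter ℕ)] fun n => S.ξ n ^ 4) :
    S.Vanishing := by
  have hne : ∀ᶠ n in (S.l : Filter ℕ), S.ξ n ≠ 0 := Eventually.of_forall S.ξ_ne
  have b4 : (fun n => S.ξ n ^ 4) =O[(S.l : Filter ℕ)] fun n => S.ξ n ^ 3 :=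
    ((isBigO_refl (fun n => S.ξ n ^ 3) _).mul h1).congr (fun n => by ring) fun n => mul_one _
  have b3 : (fun n => S.ξ n ^ 3) =O[(S.l : Filter ℕ)] fun n => S.ξ n ^ 2 :=
    ((isBigO_refl (fun n => S.ξ n ^ 2) _).mul h1).congr (fun n => by ring) fun n => mul_one _
  have b2 : (fun n => S.ξ n ^ 2) =O[(S.l : Filter ℕ)] S.ξ :=
    ((isBigO_refl S.ξ _).mul h1).congr (fun n => by ring) fun n => mul_one _
  have hF3 := fun i => (hF i).trans_isBigO b4
  have hF2 := fun i => (hF3 i).trans_isBigO b3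
  have hFξ := fun i => (hF2 i).trans_isBigO b2
  have hF1 := fun i => (hFξ i).trans_isBigO h1
  have hηξ := hη.trans_isBigO b2
  have hη1 := hηξ.trans_isBigO h1
  rcases isBigO_or_isLittleO S.l S.μ (fun _ => (1 : ℂ)) with hμ1 | hμ1
  swap
  · exact S.vanishing_of_one_isLittleO (h1.trans_isLittleO hμ1) hμ1 hη1 hF1
  have cancel : ∀ f g : ℕ → ℂ, (fun n => S.ξ n * f n) =o[(S.l : Filter ℕ)]
      (fun n => S.ξ n * g n) → f =o[(S.l : Filter ℕ)] g := fun f g =>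
    isLittleO_of_mul_left hne
  have hw : (fun n => γ * S.u n - k₄ * S.σ n) =o[(S.l : Filter ℕ)] S.ξ := by
    apply cancel
    have hμη : (fun n => S.μ n * S.η n) =o[(S.l : Filter ℕ)] fun n => S.ξ n ^ 2 :=
      (hμ1.mul_isLittleO hη).congr_right fun n => one_mul _
    refine ((((hμη.const_mul_left (-Complex.I)).sub hδ).add (hF2 7)).const_mul_left
      (-Complex.I) |>.congr_left fun n => ?_).congr_right fun n => sq _
    linear_combination Complex.I * S.eqw n
      + (-(S.ξ n * (γ * S.u n - k₄ * S.σ n))) * Complex.I_sq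
  have hμw : (fun n => S.μ n * (γ * S.u n - k₄ * S.σ n)) =o[(S.l : Filter ℕ)]
      fun n => S.ξ n * S.μ n :=
    ((isBigO_refl S.μ _).mul_isLittleO hw).congr_right fun n => mul_comm _ _
  have hξη : (fun n => S.ξ n * S.η n) =o[(S.l : Filter ℕ)] fun n => S.ξ n ^ 3 :=
    ((isBigO_refl S.ξ _).mul_isLittleO hη).congr_right fun n => by ring
  -- The comparison function is left free because the bound is needed with `g = 1`, `g = μ` and `g =
  -- ξ`, according to the size of `μ`.
  have hv : ∀ g : ℕ → ℂ, S.μ =O[(S.l : Filter ℕ)] g → (fun n => S.ξ n ^ 2) =O[(S.l : Filter ℕ)] g →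
      S.v =o[(S.l : Filter ℕ)] g := by
    intro g hg hg2
    apply cancel
    have c1 : (fun n => S.ξ n * S.μ n) =O[(S.l : Filter ℕ)] fun n => S.ξ n * g n :=
      (isBigO_refl S.ξ _).mul hg
    have c2 : (fun n => S.ξ n ^ 3) =O[(S.l : Filter ℕ)] fun n => S.ξ n * g n :=
      ((isBigO_refl S.ξ _).mul hg2).congr_left fun n => by ring
    refine (((((hμw.trans_isBigO c1).const_mul_left Complex.I).add
      ((hξη.trans_isBigO c2).const_mul_left ((γ ^ 2 + k₄) * Complex.I))).sub
      (((hF3 1).trans_isBigO c2).const_mul_left γ)).add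
      (((hF3 6).trans_isBigO c2).const_mul_left k₄)).const_mul_left
      (-Complex.I / (γ * k₁)) |>.congr_left fun n => ?_
    field_simp
    linear_combination Complex.I * S.eqw_time n + (-(γ * k₁ * S.ξ n * S.v n)) * Complex.I_sq
  have hv1 : S.v =o[(S.l : Filter ℕ)] fun _ => (1 : ℂ) := hv _ hμ1 (b2.trans h1)
  rcases isBigO_or_isLittleO S.l S.μ S.ξ with h | h
  swap
  · exact S.vanishing_of_isLittleO h (hv _ (isBigO_refl _ _) (b2.trans_isLittleO h).isBigO)
      hv1 hη1 fun i => (hFξ i).trans h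
  have hvξ : S.v =o[(S.l : Filter ℕ)] S.ξ := hv _ h b2
  have hμv : (fun n => S.μ n * S.v n) =o[(S.l : Filter ℕ)] fun n => S.ξ n ^ 2 :=
    (h.mul_isLittleO hvξ).congr_right fun n => (sq _).symm
  have hξv : (fun n => S.ξ n * S.v n) =o[(S.l : Filter ℕ)] fun n => S.ξ n ^ 2 :=
    ((isBigO_refl S.ξ _).mul_isLittleO hvξ).congr_right fun n => (sq _).symm
  have hp : (fun n => Complex.I * S.ξ n * S.u n + S.y n + S.θ n)
      =o[(S.l : Filter ℕ)] fun n => S.ξ n ^ 2 := by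
    refine ((hμv.const_mul_left Complex.I).sub (hF2 0)).congr_left fun n => ?_
    linear_combination S.eqv n
  obtain ⟨hz, hy, hφ, hθ⟩ := S.beams_vanish hk₂ hk₃ hχ h hvξ (hξv.trans_isBigO (b2.trans h1))
    (hξη.trans_isBigO (b3.trans (b2.trans h1))) (hp.trans_isBigO (b2.trans h1)) (hF1 1) hFξ
  have hu : S.u =o[(S.l : Filter ℕ)] fun _ => (1 : ℂ) := by
    -- Dividing `iξu + y + θ` by `ξ` requires `y + θ = o(ξ)`, not merely `o(1)`. For `μ = O(ξ²)`
    -- this follows from the sum of the `z` and `φ` equations; otherwise `ξ² = o(μ)` and the `u`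
    -- equation alone suffices.
    rcases isBigO_or_isLittleO S.l S.μ (fun n => S.ξ n ^ 2) with h2 | h2
    · have hyθ : (fun n => S.y n + S.θ n) =o[(S.l : Filter ℕ)] S.ξ := by
        apply cancel
        have : (fun n => S.μ n * (S.z n + S.φ n)) =o[(S.l : Filter ℕ)] fun n => S.ξ n ^ 2 :=
          (h2.mul_isLittleO (hz.add hφ)).congr_right fun n => mul_one _
        refine (((this.const_mul_left Complex.I).sub (hF2 2)).sub (hF2 4)).const_mul_left
          (-Complex.I) |>.congr (fun n => ?_) fun n => sq _
        linear_combination (-Complex.I) * (S.eqz n + S.eqφ n)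
          + (-(S.ξ n * (S.y n + S.θ n))) * Complex.I_sq
      apply isLittleO_one_of_mul hne
      exact ((hp.trans_isBigO b2).sub hyθ).congr_left fun n => by ring
    · apply isLittleO_one_of_mul (a := S.μ)
      · filter_upwards [isLittleO_iff.1 h2 one_pos] with n hn h0
        rw [h0, norm_zero, mul_zero] at hn
        exact pow_ne_zero 2 (S.ξ_ne n) (norm_le_zero_iff.1 hn)
      · simp_rw [S.equ]
        refine IsLittleO.trans ?_ h2
        refine ((hξv.const_mul_left (Complex.I * k₁)).sub
          ((hξη.trans_isBigO b3).const_mul_left (Complex.I * γ))).add (hF2 1) |>.congr_left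
          fun n => by ring
  refine ⟨hv1, hu, hz, hy, hφ, hθ, ?_, hη1⟩
  refine ((hu.const_mul_left γ).sub (hw.trans_isBigO h1)).const_mul_left k₄⁻¹ |>.congr_left
    fun n => ?_
  field_simp
  ring

end ApproxMode

end LaminatedBeam

end

noncomputable section

namespace LaminatedBeam

open Asymptotics Filter

/-! ### The resolvent bound -/

/-- The symbol `ξ² A₂ - i ξ A₁ - A₀` of the system in Fourier space. -/
def symbol (p : Coefficients) (d : HeatDissipation) (ξ : ℝ) : State →L[ℂ] State :=
  (ξ : ℂ) ^ 2 • act (matA₂ p d) - (Complex.I * (ξ : ℂ)) • act (matA₁ p) - act (matA₀ p d)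

/-- The damping rate of the last component. -/
def damping (k₅ : ℝ) : HeatDissipation → ℝ → ℝ
  | .strong, ξ => k₅ * ξ ^ 2
  | .weak, _ => k₅

/-- The energy density of the state `x`. -/
def energy (k₁ k₂ k₃ k₄ : ℝ) (x : State) : ℝ :=
  k₁ * ‖x 0‖ ^ 2 + ‖x 1‖ ^ 2 + k₂ * ‖x 2‖ ^ 2 + ‖x 3‖ ^ 2 + k₃ * ‖x 4‖ ^ 2 + ‖x 5‖ ^ 2
    + k₄ * ‖x 6‖ ^ 2 + ‖x 7‖ ^ 2

/-- The energy pairing of two states. -/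
def energyPairing (k₁ k₂ k₃ k₄ : ℝ) (x w : State) : ℝ :=
  (starRingEnd ℂ (x 0) * (k₁ * w 0) + starRingEnd ℂ (x 1) * w 1
    + starRingEnd ℂ (x 2) * (k₂ * w 2) + starRingEnd ℂ (x 3) * w 3
    + starRingEnd ℂ (x 4) * (k₃ * w 4) + starRingEnd ℂ (x 5) * w 5
    + starRingEnd ℂ (x 6) * (k₄ * w 6) + starRingEnd ℂ (x 7) * w 7).re

section Symbol

variable (k₁ k₂ k₃ k₄ k₅ γ : ℝ) (d : HeatDissipation) (ξ : ℝ) (x : State)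

theorem act_apply (A : Matrix (Fin 8) (Fin 8) ℝ) (i : Fin 8) :
    act A x i = ∑ j, (A i j : ℂ) * x j := by
  rw [act, Matrix.ofLp_toEuclideanCLM]
  simp [Matrix.mulVec, dotProduct]

theorem symbol_apply (i : Fin 8) :
    symbol (transversal k₁ k₂ k₃ k₄ k₅ γ) d ξ x i =
      ![Complex.I * ξ * x 1 + x 3 + x 5,
        Complex.I * ξ * (k₁ * x 0) - Complex.I * ξ * (γ * x 7),
        Complex.I * ξ * x 3,
        Complex.I * ξ * (k₂ * x 2) - k₁ * x 0,
        Complex.I * ξ * x 5,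
        Complex.I * ξ * (k₃ * x 4) - k₁ * x 0,
        Complex.I * ξ * x 7,
        Complex.I * ξ * (k₄ * x 6) - Complex.I * ξ * (γ * x 1)
          - damping k₅ d ξ * x 7] i := by
  simp only [symbol, sub_apply, smul_apply,
    PiLp.sub_apply, PiLp.smul_apply, smul_eq_mul, act_apply, Fin.sum_univ_eight]
  fin_cases i <;> cases d <;>
    simp [matA₀, matA₁, matA₂, transversal, damping, HeatDissipation.eps] <;> ring

/-- All couplings, including `γ` and the zero-order terms, cancel in the real part; only the damping
of the last component survives. -/
theorem energyPairing_symbol :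
    energyPairing k₁ k₂ k₃ k₄ x (symbol (transversal k₁ k₂ k₃ k₄ k₅ γ) d ξ x)
      = -(damping k₅ d ξ * ‖x 7‖ ^ 2) := by
  simp only [energyPairing, symbol_apply, Complex.sq_norm, Complex.normSq_apply]
  simp
  ring

theorem energyPairing_I_mul (μ : ℝ) :
    energyPairing k₁ k₂ k₃ k₄ x ((Complex.I * μ) • x) = 0 := by
  simp [energyPairing]
  ring

theorem energyPairing_sub (w w' : State) :
    energyPairing k₁ k₂ k₃ k₄ x (w - w')
      = energyPairing k₁ k₂ k₃ k₄ x w - energyPairing k₁ k₂ k₃ k₄ x w' := by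
  simp [energyPairing]
  ring

theorem energyPairing_le (hk₁ : 0 < k₁) (hk₂ : 0 < k₂) (hk₃ : 0 < k₃) (hk₄ : 0 < k₄)
    (w : State) :
    energyPairing k₁ k₂ k₃ k₄ x w ≤ (k₁ + k₂ + k₃ + k₄ + 4) * (‖x‖ * ‖w‖) := by
  have key : ∀ (k : ℝ) (i : Fin 8), 0 ≤ k →
      (starRingEnd ℂ (x i) * (k * w i)).re ≤ k * (‖x‖ * ‖w‖) := by
    intro k i hk
    refine (Complex.re_le_norm _).trans ?_
    rw [norm_mul, norm_mul, RCLike.norm_conj, Complex.norm_real, Real.norm_of_nonneg hk]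
    calc ‖x i‖ * (k * ‖w i‖) = k * (‖x i‖ * ‖w i‖) := by ring
      _ ≤ k * (‖x‖ * ‖w‖) := by
        gcongr
        · exact PiLp.norm_apply_le x i
        · exact PiLp.norm_apply_le w i
  have key1 := fun i => key 1 i zero_le_one
  simp only [Complex.ofReal_one, one_mul] at key1
  simp only [energyPairing, Complex.add_re]
  linarith [key k₁ 0 hk₁.le, key k₂ 2 hk₂.le, key k₃ 4 hk₃.le, key k₄ 6 hk₄.le, key1 1, key1 3,
    key1 5, key1 7]

end Symbol

/-! ### Bounds on the weight, as the energy argument uses them. -/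

section Weight

variable (d : HeatDissipation) (ξ : ℝ)

theorem weight_nonneg : 0 ≤ weight d ξ := by
  cases d <;> simp only [weight] <;> positivity

theorem weight_le_one : weight d ξ ≤ 1 := by
  cases d <;> simp only [weight] <;> rw [div_le_one (by positivity)] <;>
    nlinarith [sq_nonneg ξ, sq_nonneg (ξ ^ 2), sq_nonneg (ξ ^ 3), sq_nonneg (ξ ^ 4)]

theorem weight_le_pow_four : weight d ξ ≤ ξ ^ 4 := by
  cases d <;> simp only [weight] <;> rw [div_le_iff₀ (by positivity)]
  · nlinarith [sq_nonneg (ξ ^ 2), sq_nonneg (ξ ^ 4), sq_nonneg (ξ ^ 5), sq_nonneg (ξ ^ 6)]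
  · nlinarith [sq_nonneg (ξ ^ 3), sq_nonneg (ξ ^ 4), sq_nonneg (ξ ^ 5)]

/-- This yields `η = o(ξ²)` at low frequencies. The extra `ξ²` in the strong damping explains the
order of vanishing `6` against `4`. -/
theorem weight_le_damping_mul_pow_four {k₅ : ℝ} (hk₅ : 0 < k₅) :
    k₅ * weight d ξ ≤ damping k₅ d ξ * ξ ^ 4 := by
  cases d
  · simp only [damping, mul_assoc]
    refine mul_le_mul_of_nonneg_left ?_ hk₅.le
    simp only [weight]
    rw [div_le_iff₀ (by positivity)]
    nlinarith [sq_nonneg (ξ ^ 4), sq_nonneg (ξ ^ 5), sq_nonneg (ξ ^ 6), sq_nonneg (ξ ^ 7)]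
  · exact mul_le_mul_of_nonneg_left (weight_le_pow_four _ _) hk₅.le

/-- The high-frequency loss. It makes `ξ η` small under weak damping, and the damping term `δ` small
under strong damping. -/
theorem sq_mul_weight_le_one : ξ ^ 2 * weight d ξ ≤ 1 := by
  cases d <;> simp only [weight] <;> rw [← mul_div_assoc, div_le_one (by positivity)] <;>
    nlinarith [sq_nonneg ξ, sq_nonneg (ξ ^ 2), sq_nonneg (ξ ^ 3), sq_nonneg (ξ ^ 4)]

theorem sq_mul_weight_le_damping {k₅ : ℝ} (hk₅ : 0 < k₅) :
    k₅ * (ξ ^ 2 * weight d ξ) ≤ damping k₅ d ξ := by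
  cases d
  · exact mul_le_mul_of_nonneg_left
      (mul_le_of_le_one_right (sq_nonneg _) (weight_le_one _ _)) hk₅.le
  · exact mul_le_of_le_one_right hk₅.le (sq_mul_weight_le_one _ _)

theorem damping_mul_weight_le {k₅ : ℝ} (hk₅ : 0 < k₅) : damping k₅ d ξ * weight d ξ ≤ k₅ := by
  cases d
  · rw [damping, mul_assoc]
    exact mul_le_of_le_one_right hk₅.le (sq_mul_weight_le_one _ _)
  · exact mul_le_of_le_one_right hk₅.le (weight_le_one _ _)

end Weight

theorem isLittleO_of_norm_le {l : Filter ℕ} (hl : l ≤ atTop) (K : ℝ) {f g : ℕ → ℂ}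
    (h : ∀ n, ‖f n‖ ≤ K * (1 / ((n : ℝ) + 1)) * ‖g n‖) : f =o[l] g := by
  have ht : Tendsto (fun n : ℕ => K * (1 / ((n : ℝ) + 1))) l (nhds 0) := by
    simpa using (tendsto_one_div_add_atTop_nhds_zero_nat (𝕜 := ℝ)).const_mul K |>.mono_left hl
  rw [isLittleO_iff]
  intro c hc
  filter_upwards [ht.eventually_le_const hc] with n hn
  exact (h n).trans (mul_le_mul_of_nonneg_right hn (norm_nonneg _))

/-- The resolvent of the symbol on the imaginary axis is at most of size `1 / weight`. -/
theorem exists_resolvent_bound {k₁ k₂ k₃ k₄ k₅ γ : ℝ}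
    (hk₁ : 0 < k₁) (hk₂ : 0 < k₂) (hk₃ : 0 < k₃) (hk₄ : 0 < k₄) (hk₅ : 0 < k₅)
    (hγ : γ ≠ 0) (hχ : k₃ - k₂ ≠ 0) (d : HeatDissipation) :
    ∃ c : ℝ, 0 < c ∧ ∀ (ξ μ : ℝ) (x : State), c * weight d ξ * ‖x‖
      ≤ ‖(Complex.I * μ) • x - symbol (transversal k₁ k₂ k₃ k₄ k₅ γ) d ξ x‖ := by
  -- Testing with the constants `1 / (n + 1)` produces unit vectors whose error is `o(weight)`. The
  -- strict inequality excludes `ξ = 0`, where the weight vanishes.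
  by_contra! h
  have h' : ∀ n : ℕ, ∃ (ξ μ : ℝ) (x : State), ‖x‖ = 1 ∧ ξ ≠ 0 ∧
      ‖(Complex.I * μ) • x - symbol (transversal k₁ k₂ k₃ k₄ k₅ γ) d ξ x‖
        ≤ 1 / ((n : ℝ) + 1) * weight d ξ := by
    intro n
    obtain ⟨ξ, μ, x, hx⟩ := h (1 / ((n : ℝ) + 1)) (by positivity)
    have hx0 : x ≠ 0 := by
      rintro rfl
      simp at hx
    refine ⟨ξ, μ, (‖x‖⁻¹ : ℂ) • x, ?_, ?_, ?_⟩
    · rw [norm_smul, norm_inv, Complex.norm_real, norm_norm,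
        inv_mul_cancel₀ (norm_ne_zero_iff.2 hx0)]
    · rintro rfl
      have : weight d 0 = 0 := by cases d <;> simp [weight]
      rw [this, mul_zero, zero_mul] at hx
      exact (norm_nonneg _).not_gt hx
    · rw [map_smul, smul_comm, ← smul_sub, norm_smul, norm_inv, Complex.norm_real, norm_norm,
        inv_mul_le_iff₀ (norm_pos_iff.2 hx0), mul_comm ‖x‖]
      exact hx.le
  choose ξ μ x hx1 hξ hF using h'
  set M := fun n => symbol (transversal k₁ k₂ k₃ k₄ k₅ γ) d (ξ n)
  have hl : ((hyperfilter ℕ : Ultrafilter ℕ) : Filter ℕ) ≤ atTop := Nat.hyperfilter_le_atTop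
  have hO : ∀ i, (fun n => x n i) =O[((hyperfilter ℕ : Ultrafilter ℕ) : Filter ℕ)]
      fun _ => (1 : ℂ) := fun i => by
    refine IsBigO.of_bound 1 (Eventually.of_forall fun n => ?_)
    rw [norm_one, mul_one, ← hx1 n]
    exact PiLp.norm_apply_le _ _
  let S : ApproxMode k₁ k₂ k₃ k₄ γ :=
    { μ := fun n => μ n, ξ := fun n => ξ n,
      v := fun n => x n 0, u := fun n => x n 1, z := fun n => x n 2, y := fun n => x n 3,
      φ := fun n => x n 4, θ := fun n => x n 5, σ := fun n => x n 6, η := fun n => x n 7,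
      δ := fun n => damping k₅ d (ξ n) * x n 7,
      F := fun i n => ((Complex.I * μ n) • x n - M n (x n)) i,
      l := hyperfilter ℕ,
      ξ_ne := fun n => Complex.ofReal_ne_zero.2 (hξ n)
      eqv := fun n => by simp [M, symbol_apply]
      equ := fun n => by simp [M, symbol_apply]
      eqz := fun n => by simp [M, symbol_apply]
      eqy := fun n => by simp [M, symbol_apply]
      eqφ := fun n => by simp [M, symbol_apply]
      eqθ := fun n => by simp [M, symbol_apply]
      eqσ := fun n => by simp [M, symbol_apply]
      eqη := fun n => by simp [M, symbol_apply]
      bv := hO 0, bu := hO 1, bz := hO 2, bY := hO 3, bφ := hO 4, bθ := hO 5 }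
  have hFi : ∀ i n, ‖S.F i n‖ ≤ 1 / ((n : ℝ) + 1) * weight d (ξ n) := fun i n =>
    (PiLp.norm_apply_le _ i).trans (hF n)
  set C := k₁ + k₂ + k₃ + k₄ + 4 with hC
  have hC0 : 0 < C := by positivity
  -- Pairing the resolvent equation with the mode itself removes the skew part and `iμ`, leaving the
  -- dissipation bounded by the error.
  have hη : ∀ n, damping k₅ d (ξ n) * ‖S.η n‖ ^ 2
      ≤ C * (1 / ((n : ℝ) + 1)) * weight d (ξ n) := by
    intro n
    have h1 := energyPairing_le k₁ k₂ k₃ k₄ (x n) hk₁ hk₂ hk₃ hk₄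
      ((Complex.I * μ n) • x n - M n (x n))
    rw [energyPairing_sub, energyPairing_I_mul, energyPairing_symbol, hx1, one_mul, zero_sub,
      neg_neg] at h1
    refine h1.trans ?_
    rw [mul_assoc]
    exact mul_le_mul_of_nonneg_left (hF n) hC0.le
  have hd : ∀ n, 0 < damping k₅ d (ξ n) := by
    intro n
    have := hξ n
    cases d <;> simp only [damping] <;> positivity
  have hV : S.Vanishing := by
    have nz : ∀ k : ℝ, k ≠ 0 → (k : ℂ) ≠ 0 := fun k hk => Complex.ofReal_ne_zero.2 hk
    have hχ' : (k₃ : ℂ) - k₂ ≠ 0 := by exact_mod_cast hχ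
    -- Along the ultrafilter the frequencies are either bounded or tend to infinity.
    rcases isBigO_or_isLittleO S.l S.ξ (fun _ => (1 : ℂ)) with h1 | h1
    · have hηo : S.η =o[(S.l : Filter ℕ)] fun n => S.ξ n ^ 2 := by
        refine IsLittleO.of_pow (n := 2) ?_ two_ne_zero
        refine isLittleO_of_norm_le hl (C * k₅⁻¹) fun n => ?_
        have h2 := weight_le_damping_mul_pow_four d (ξ n) hk₅
        simp only [S, Pi.pow_apply, norm_pow, Complex.norm_real, Real.norm_eq_abs]
        have h3 : (|ξ n| ^ 2) ^ 2 = ξ n ^ 4 := by rw [sq_abs]; ring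
        rw [h3]
        refine le_of_mul_le_mul_left ((hη n).trans ?_) (hd n)
        calc C * (1 / ((n : ℝ) + 1)) * weight d (ξ n)
            = C * k₅⁻¹ * (1 / ((n : ℝ) + 1)) * (k₅ * weight d (ξ n)) := by field_simp
          _ ≤ C * k₅⁻¹ * (1 / ((n : ℝ) + 1)) * (damping k₅ d (ξ n) * ξ n ^ 4) := by gcongr
          _ = _ := by ring
      refine S.vanishing_of_low (nz _ hk₁.ne') (nz _ hk₂.ne') (nz _ hk₃.ne') (nz _ hk₄.ne')
        (nz _ hγ) hχ' h1 hηo ?_ fun i => ?_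
      · have hD : (fun n => (damping k₅ d (ξ n) : ℂ)) =O[(S.l : Filter ℕ)] fun _ => (1 : ℂ) := by
          cases d
          · have := (h1.pow 2).const_mul_left (k₅ : ℂ)
            simpa [damping, S] using this
          · exact isBigO_const_const (k₅ : ℂ) one_ne_zero _
        exact (hD.mul_isLittleO hηo).congr_right fun n => one_mul _
      · refine isLittleO_of_norm_le hl 1 fun n => (hFi i n).trans ?_
        rw [one_mul]
        refine mul_le_mul_of_nonneg_left ?_ (by positivity)
        simp only [S, norm_pow, Complex.norm_real, Real.norm_eq_abs]
        have h3 : |ξ n| ^ 4 = ξ n ^ 4 := Even.pow_abs (by decide) _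
        rw [h3]
        exact weight_le_pow_four _ _
    · refine S.vanishing_of_high (nz _ hk₁.ne') (nz _ hk₂.ne') (nz _ hk₃.ne') (nz _ hk₄.ne')
        (nz _ hγ) hχ' h1.isBigO ?_ ?_ fun i => ?_
      · refine IsLittleO.of_pow (n := 2) ?_ two_ne_zero
        refine isLittleO_of_norm_le hl (C * k₅⁻¹) fun n => ?_
        have h2 := sq_mul_weight_le_damping d (ξ n) hk₅
        simp only [S, Pi.pow_apply, norm_pow, norm_mul, Complex.norm_real, Real.norm_eq_abs,
          norm_one, one_pow, mul_one, mul_pow, sq_abs]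
        refine le_of_mul_le_mul_left ?_ (hd n)
        calc damping k₅ d (ξ n) * (ξ n ^ 2 * ‖x n 7‖ ^ 2)
            = ξ n ^ 2 * (damping k₅ d (ξ n) * ‖x n 7‖ ^ 2) := by ring
          _ ≤ ξ n ^ 2 * (C * (1 / ((n : ℝ) + 1)) * weight d (ξ n)) :=
            mul_le_mul_of_nonneg_left (hη n) (sq_nonneg _)
          _ = C * k₅⁻¹ * (1 / ((n : ℝ) + 1)) * (k₅ * (ξ n ^ 2 * weight d (ξ n))) := by field_simp
          _ ≤ C * k₅⁻¹ * (1 / ((n : ℝ) + 1)) * damping k₅ d (ξ n) := by gcongr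
          _ = _ := by ring
      · refine IsLittleO.of_pow (n := 2) ?_ two_ne_zero
        refine isLittleO_of_norm_le hl (C * k₅) fun n => ?_
        have h2 := damping_mul_weight_le d (ξ n) hk₅
        simp only [S, Pi.pow_apply, norm_pow, norm_mul, Complex.norm_real, Real.norm_eq_abs,
          norm_one, one_pow, mul_one, mul_pow, sq_abs]
        calc damping k₅ d (ξ n) ^ 2 * ‖x n 7‖ ^ 2
            = damping k₅ d (ξ n) * (damping k₅ d (ξ n) * ‖x n 7‖ ^ 2) := by ring
          _ ≤ damping k₅ d (ξ n) * (C * (1 / ((n : ℝ) + 1)) * weight d (ξ n)) :=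
            mul_le_mul_of_nonneg_left (hη n) (hd n).le
          _ = C * (1 / ((n : ℝ) + 1)) * (damping k₅ d (ξ n) * weight d (ξ n)) := by ring
          _ ≤ C * (1 / ((n : ℝ) + 1)) * k₅ := by gcongr
          _ = _ := by ring
      · refine isLittleO_of_norm_le hl 1 fun n => (hFi i n).trans ?_
        rw [one_mul, norm_one]
        exact mul_le_mul_of_nonneg_left (weight_le_one _ _) (by positivity)
  obtain ⟨h0, h1, h2, h3, h4, h5, h6, h7⟩ := hV
  have ht : ∀ i, Tendsto (fun n => ‖x n i‖ ^ 2) (S.l : Filter ℕ) (nhds 0) := by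
    intro i
    have : (fun n => x n i) =o[(S.l : Filter ℕ)] fun _ => (1 : ℂ) := by
      fin_cases i <;> assumption
    simpa using ((isLittleO_one_iff ℂ).1 this).norm.pow 2
  have hsum := tendsto_finsetSum Finset.univ fun i _ => ht i
  have hone : ∀ n, ∑ i, ‖x n i‖ ^ 2 = 1 := fun n => by
    rw [← EuclideanSpace.norm_sq_eq, hx1, one_pow]
  simp only [hone, Finset.sum_const_zero] at hsum
  exact one_ne_zero (tendsto_nhds_unique tendsto_const_nhds hsum)

end LaminatedBeam

end

noncomputable section

namespace LaminatedBeam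

/-! ### From resolvent bounds to exponential decay -/

section Gearhart

open Filter Topology FourierTransform ContDiff

variable {H : Type*} [NormedAddCommGroup H] [InnerProductSpace ℂ H] [CompleteSpace H]

omit [CompleteSpace H] in
theorem contDiff_of_hasDerivAt_clm {A : H →L[ℂ] H} {x : ℝ → H}
    (hx : ∀ t, HasDerivAt x (A (x t)) t) : ContDiff ℝ ∞ x := by
  have hd : deriv x = fun t => A (x t) := funext fun t => (hx t).deriv
  refine contDiff_infty.2 fun n => ?_
  induction n with
  | zero => exact contDiff_zero.2 (continuous_iff_continuousAt.2 fun t => (hx t).continuousAt)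
  | succ n ih =>
    push_cast
    refine contDiff_succ_iff_deriv.2 ⟨fun t => (hx t).differentiableAt, by simp, ?_⟩
    rw [hd]
    exact (A.restrictScalars ℝ).contDiff.comp ih

/-- Localization in time: a resolvent bound on the imaginary axis bounds a cut-off trajectory by
the commutator with the cut-off. -/
theorem integral_cutoff_le {A : H →L[ℂ] H} {x : ℝ → H}
    (hA : ∀ (μ : ℝ) (w : H), ‖w‖ ≤ ‖(Complex.I * μ) • w - A w‖)
    (hx : ∀ t, HasDerivAt x (A (x t)) t) {β : ℝ → ℝ} (hβ : ContDiff ℝ ∞ β)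
    (hβc : HasCompactSupport β) :
    ∫ t, ‖β t • x t‖ ^ 2 ≤ ∫ t, ‖deriv β t • x t‖ ^ 2 := by
  have hxs := contDiff_of_hasDerivAt_clm hx
  have hβ's : ContDiff ℝ ∞ (deriv β) := by
    have : ContDiff ℝ (∞ + 1) β := hβ
    exact (contDiff_succ_iff_deriv.1 this).2.2
  have c1 : HasCompactSupport fun t => β t • x t := hβc.smul_right
  have c2 : HasCompactSupport fun t => deriv β t • x t := hβc.deriv.smul_right
  let f : 𝓢(ℝ, H) := c1.toSchwartzMap (hβ.smul hxs)
  let g : 𝓢(ℝ, H) := c2.toSchwartzMap (hβ's.smul hxs)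
  -- Since `x' = A x`, the commutator is `β' x = (β x)' - A (β x)`. Its transform is the resolvent
  -- expression at `μ = 2πτ`, so the hypothesis applies under Plancherel.
  have hg : ∀ τ, 𝓕 g τ = (Complex.I * ((2 * Real.pi * τ : ℝ) : ℂ)) • 𝓕 f τ - A (𝓕 f τ) := by
    intro τ
    have h1 : g = SchwartzMap.derivCLM ℂ H f - f.postcompCLM A := by
      ext t
      have hft : HasDerivAt f (β t • A (x t) + deriv β t • x t) t :=
        ((hβ.differentiable (by simp)).differentiableAt.hasDerivAt (x := t)).smul (hx t)
      simp only [sub_apply, SchwartzMap.derivCLM_apply,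
        SchwartzMap.postcompCLM_apply, hft.deriv]
      simp [f, g]
    have h0 : 𝓕 g = 𝓕 (SchwartzMap.derivCLM ℂ H f) - 𝓕 (f.postcompCLM A) := by
      rw [h1]
      exact map_sub (SchwartzMap.fourierTransformCLM ℂ) _ _
    rw [h0, sub_apply]
    congr 1
    · have := Real.fourier_deriv (f := f) f.integrable f.differentiable
        (SchwartzMap.derivCLM ℂ H f).integrable
      have h2 : 𝓕 (SchwartzMap.derivCLM ℂ H f) τ = 𝓕 (deriv f) τ := by
        rw [SchwartzMap.fourier_coe]
        rfl
      rw [h2, this]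
      simp only [SchwartzMap.fourier_coe]
      congr 1
      push_cast
      ring
    · simp only [SchwartzMap.fourier_coe, Real.fourier_eq]
      rw [← A.integral_comp_comm]
      · simp [Circle.smul_def]
      · exact (Real.fourierIntegral_convergent_iff τ).2 f.integrable
  have key := integral_mono (μ := volume) (f := fun τ => ‖𝓕 f τ‖ ^ 2)
    (g := fun τ => ‖𝓕 g τ‖ ^ 2) ?_ ?_ fun τ => ?_
  · rwa [SchwartzMap.integral_norm_sq_fourier, SchwartzMap.integral_norm_sq_fourier] at key
  · exact ((𝓕 f).memLp 2).integrable_norm_pow two_ne_zero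
  · exact ((𝓕 g).memLp 2).integrable_norm_pow two_ne_zero
  · simp only [hg]
    gcongr
    exact hA _ _

/-- The smooth cut-off that increases on `[0, 1]` and decreases on `[L - 1, L]`. -/
def cutoff (L t : ℝ) : ℝ := Real.smoothTransition t * Real.smoothTransition (L - t)

theorem contDiff_cutoff (L : ℝ) : ContDiff ℝ ∞ (cutoff L) :=
  Real.smoothTransition.contDiff.mul
    (Real.smoothTransition.contDiff.comp (contDiff_const.sub contDiff_id))

theorem cutoff_eq_zero {L t : ℝ} (ht : t ∉ Icc 0 L) : cutoff L t = 0 := by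
  rcases not_and_or.1 ht with h | h
  · rw [cutoff, Real.smoothTransition.zero_of_nonpos (by linarith), zero_mul]
  · rw [cutoff, Real.smoothTransition.zero_of_nonpos (x := L - t) (by linarith), mul_zero]

theorem cutoff_eq_one {L t : ℝ} (ht : t ∈ Icc 1 (L - 1)) : cutoff L t = 1 := by
  rw [cutoff, Real.smoothTransition.one_of_one_le ht.1,
    Real.smoothTransition.one_of_one_le (by linarith [ht.2]), mul_one]

theorem hasCompactSupport_cutoff (L : ℝ) : HasCompactSupport (cutoff L) :=
  HasCompactSupport.intro isCompact_Icc fun _ => cutoff_eq_zero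

theorem deriv_smoothTransition_eq_zero {t : ℝ} (ht : t ∉ Icc (0 : ℝ) 1) :
    deriv Real.smoothTransition t = 0 := by
  rcases not_and_or.1 ht with h | h
  · have : Real.smoothTransition =ᶠ[𝓝 t] fun _ => 0 := by
      filter_upwards [Iio_mem_nhds (not_le.1 h)] with s hs
      exact Real.smoothTransition.zero_of_nonpos (le_of_lt hs)
    rw [this.deriv_eq, deriv_const]
  · have : Real.smoothTransition =ᶠ[𝓝 t] fun _ => 1 := by
      filter_upwards [Ioi_mem_nhds (not_le.1 h)] with s hs
      exact Real.smoothTransition.one_of_one_le (le_of_lt hs)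
    rw [this.deriv_eq, deriv_const]

theorem exists_abs_deriv_smoothTransition_le :
    ∃ K : ℝ, 0 ≤ K ∧ ∀ t, |deriv Real.smoothTransition t| ≤ K := by
  have hc : Continuous (deriv Real.smoothTransition) :=
    (Real.smoothTransition.contDiff (n := 1)).continuous_deriv le_rfl
  have hs : HasCompactSupport (deriv Real.smoothTransition) :=
    HasCompactSupport.intro isCompact_Icc fun _ => deriv_smoothTransition_eq_zero
  obtain ⟨K, hK⟩ := hc.bounded_above_of_compact_support hs
  exact ⟨K, (norm_nonneg _).trans (hK 0), hK⟩

/-- The slopes of the cut-offs are bounded uniformly in the length of the plateau. -/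
theorem exists_abs_deriv_cutoff_le : ∃ K : ℝ, 0 ≤ K ∧ ∀ L t : ℝ,
    |deriv (cutoff L) t| ≤ K ∧ (t ∉ Icc 0 1 ∪ Icc (L - 1) L → deriv (cutoff L) t = 0) := by
  obtain ⟨K, hK0, hK⟩ := exists_abs_deriv_smoothTransition_le
  refine ⟨2 * K, by positivity, fun L t => ?_⟩
  have hS : ∀ t, HasDerivAt Real.smoothTransition (deriv Real.smoothTransition t) t := fun t =>
    ((Real.smoothTransition.contDiff (n := 1)).differentiable one_ne_zero t).hasDerivAt
  have hd : deriv (cutoff L) t = deriv Real.smoothTransition t * Real.smoothTransition (L - t)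
      + Real.smoothTransition t * (deriv Real.smoothTransition (L - t) * (-1)) :=
    ((hS t).mul ((hS (L - t)).comp t ((hasDerivAt_id t).const_sub L))).deriv
  have h1 := Real.smoothTransition.nonneg t
  have h2 := Real.smoothTransition.le_one t
  have h3 := Real.smoothTransition.nonneg (L - t)
  have h4 := Real.smoothTransition.le_one (L - t)
  constructor
  · rw [hd]
    refine (abs_add_le _ _).trans ?_
    rw [abs_mul, abs_mul, abs_mul, abs_of_nonneg h1, abs_of_nonneg h3, abs_neg, abs_one, mul_one,
      two_mul]
    gcongr
    · exact (mul_le_of_le_one_right (abs_nonneg _) h4).trans (hK _)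
    · exact (mul_le_of_le_one_left (abs_nonneg _) h2).trans (hK _)
  · intro ht
    rw [mem_union, not_or] at ht
    rw [hd, deriv_smoothTransition_eq_zero ht.1, deriv_smoothTransition_eq_zero fun h => ht.2
      ⟨by linarith [h.2], by linarith [h.1]⟩]
    simp

/-- If the resolvent is bounded by one on the imaginary axis, a monotone energy is halved after
a time that depends only on the equivalence constants of the energy. -/
theorem exists_half_time {m M : ℝ} (hm : 0 < m) (hM : 0 < M) :
    ∃ L : ℝ, 0 < L ∧ ∀ (A : H →L[ℂ] H) (x : ℝ → H) (E : H → ℝ),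
      (∀ (μ : ℝ) (w : H), ‖w‖ ≤ ‖(Complex.I * μ) • w - A w‖) →
      (∀ t, HasDerivAt x (A (x t)) t) →
      (∀ w, m * ‖w‖ ^ 2 ≤ E w) → (∀ w, E w ≤ M * ‖w‖ ^ 2) → Antitone (fun t => E (x t)) →
      E (x L) ≤ E (x 0) / 2 := by
  obtain ⟨K, hK0, hK⟩ := exists_abs_deriv_cutoff_le
  -- With `q = 2 M K² / m`, plateau and slopes together give `(L - 1) E(x(L + 1)) ≤ q E(x 0)`. The
  -- choice `L - 1 = 1 + 2q` forces halving at time `L + 1`, independently of the generator.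
  set L := 2 + 4 * M * K ^ 2 / m with hL
  have hpos : 0 ≤ 4 * M * K ^ 2 / m := by positivity
  have hL2 : 2 ≤ L := by linarith
  refine ⟨L + 1, by linarith, fun A x E hA hx hmE hME hE => ?_⟩
  have hE0 : ∀ w, 0 ≤ E w := fun w => (by positivity : 0 ≤ m * ‖w‖ ^ 2).trans (hmE w)
  have hxc : Continuous x := (contDiff_of_hasDerivAt_clm hx).continuous
  have key := integral_cutoff_le hA hx (contDiff_cutoff (L + 1)) (hasCompactSupport_cutoff (L + 1))
  set B := K ^ 2 * (E (x 0) / m) with hB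
  have hB0 : 0 ≤ B := mul_nonneg (sq_nonneg _) (div_nonneg (hE0 _) hm.le)
  have upper : ∫ t, ‖deriv (cutoff (L + 1)) t • x t‖ ^ 2 ≤ 2 * B := by
    set s := Icc (0 : ℝ) 1 ∪ Icc (L + 1 - 1) (L + 1) with hs
    have hsm : MeasurableSet s := measurableSet_Icc.union measurableSet_Icc
    have hvol : volume.real s ≤ 2 := by
      refine (measureReal_union_le _ _).trans ?_
      rw [Real.volume_real_Icc, Real.volume_real_Icc]
      norm_num
    have hfin : volume s ≠ ⊤ :=
      (isCompact_Icc.union isCompact_Icc).measure_lt_top.ne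
    calc ∫ t, ‖deriv (cutoff (L + 1)) t • x t‖ ^ 2 ≤ ∫ t, s.indicator (fun _ => B) t := by
          refine integral_mono_of_nonneg (Filter.Eventually.of_forall fun t => by positivity)
            ((integrable_indicator_iff hsm).2 (integrableOn_const hfin))
            (Filter.Eventually.of_forall fun t => ?_)
          by_cases ht : t ∈ s
          · simp only [indicator_of_mem ht, norm_smul, mul_pow, Real.norm_eq_abs]
            have ht0 : 0 ≤ t := by
              rcases ht with ht | ht
              · exact ht.1
              · linarith [ht.1]
            rw [hB]
            gcongr
            · exact (hK (L + 1) t).1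
            · rw [le_div_iff₀ hm, mul_comm]
              exact (hmE _).trans (hE ht0)
          · simp only [indicator_of_notMem ht, (hK (L + 1) t).2 ht, zero_smul, norm_zero]
            norm_num
      _ = volume.real s * B := by rw [integral_indicator_const _ hsm, smul_eq_mul]
      _ ≤ 2 * B := by gcongr
  have lower : (L - 1) * (E (x (L + 1)) / M) ≤ ∫ t, ‖cutoff (L + 1) t • x t‖ ^ 2 := by
    have hi : Integrable fun t => ‖cutoff (L + 1) t • x t‖ ^ 2 := by
      refine Continuous.integrable_of_hasCompactSupport ?_ ?_
      · exact (((contDiff_cutoff (L + 1)).continuous.smul hxc).norm).pow 2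
      · exact (hasCompactSupport_cutoff (L + 1)).mono' fun t ht => subset_tsupport _ fun h0 =>
          ht (by simp [h0])
    calc (L - 1) * (E (x (L + 1)) / M)
        = ∫ t, (Icc (1 : ℝ) L).indicator (fun _ => E (x (L + 1)) / M) t := by
          rw [integral_indicator_const _ measurableSet_Icc, smul_eq_mul, Real.volume_real_Icc,
            max_eq_left (by linarith)]
      _ ≤ _ := by
          refine integral_mono_of_nonneg (Filter.Eventually.of_forall fun t =>
            indicator_nonneg (fun _ _ => div_nonneg (hE0 _) hM.le) t) hi
            (Filter.Eventually.of_forall fun t => ?_)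
          by_cases ht : t ∈ Icc (1 : ℝ) L
          · simp only [indicator_of_mem ht]
            rw [cutoff_eq_one ⟨ht.1, by linarith [ht.2]⟩, one_smul, div_le_iff₀ hM, mul_comm]
            exact (hE (by linarith [ht.2] : t ≤ L + 1)).trans (hME _)
          · simp only [indicator_of_notMem ht]
            positivity
  have h1 := lower.trans (key.trans upper)
  rw [hB] at h1
  have h2 : (L - 1) * E (x (L + 1)) ≤ (2 * M * K ^ 2 / m) * E (x 0) := by
    calc (L - 1) * E (x (L + 1)) = M * ((L - 1) * (E (x (L + 1)) / M)) := by field_simp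
      _ ≤ M * (2 * (K ^ 2 * (E (x 0) / m))) := by gcongr
      _ = _ := by ring
  have h3 := hE0 (x (L + 1))
  have h4 := hE0 (x 0)
  have h5 : L - 1 = 1 + 2 * (2 * M * K ^ 2 / m) := by rw [hL]; ring
  have h6 : 0 ≤ 2 * M * K ^ 2 / m := by positivity
  rw [h5] at h2
  by_contra! hcon
  nlinarith

/-- A resolvent bound on the imaginary axis yields exponential decay with explicit dependence on
the bound. -/
theorem exists_exp_decay {m M : ℝ} (hm : 0 < m) (hM : 0 < M) :
    ∃ c : ℝ, 0 < c ∧ ∀ (A : H →L[ℂ] H) (x : ℝ → H) (E : H → ℝ) (Ψ : ℝ), 0 ≤ Ψ →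
      (∀ (μ : ℝ) (w : H), Ψ * ‖w‖ ≤ ‖(Complex.I * μ) • w - A w‖) →
      (∀ t, HasDerivAt x (A (x t)) t) →
      (∀ w, m * ‖w‖ ^ 2 ≤ E w) → (∀ w, E w ≤ M * ‖w‖ ^ 2) → Antitone (fun t => E (x t)) →
      ∀ t, 0 ≤ t → E (x t) ≤ 2 * Real.exp (-c * Ψ * t) * E (x 0) := by
  obtain ⟨L, hL, key⟩ := exists_half_time (H := H) hm hM
  refine ⟨Real.log 2 / L, div_pos (Real.log_pos one_lt_two) hL,
    fun A x E Ψ hΨ hA hx hmE hME hE t ht => ?_⟩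
  have hE0 : ∀ w, 0 ≤ E w := fun w => (by positivity : 0 ≤ m * ‖w‖ ^ 2).trans (hmE w)
  rcases hΨ.eq_or_lt with rfl | hΨ
  · have h1 : E (x t) ≤ E (x 0) := hE ht
    have h2 := hE0 (x 0)
    simp only [mul_zero, zero_mul, Real.exp_zero]
    linarith
  -- Slowing time by the factor `Ψ` normalises the resolvent bound to one, so the universal
  -- half-time `L` becomes `L / Ψ`.
  have step : ∀ s, E (x (s + L / Ψ)) ≤ E (x s) / 2 := by
    intro s
    have := key ((Ψ⁻¹ : ℂ) • A) (fun r => x (s + Ψ⁻¹ * r)) E ?_ ?_ hmE hME ?_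
    · simpa [div_eq_inv_mul] using this
    · intro μ w
      have h1 := hA (Ψ * μ) w
      have h2 : (Complex.I * μ) • w - ((Ψ⁻¹ : ℂ) • A) w
          = (Ψ⁻¹ : ℂ) • ((Complex.I * ((Ψ * μ : ℝ) : ℂ)) • w - A w) := by
        have : (Ψ : ℂ) ≠ 0 := Complex.ofReal_ne_zero.2 hΨ.ne'
        rw [smul_sub, smul_smul, smul_apply]
        congr 2
        push_cast
        field_simp
      rw [h2, norm_smul, norm_inv, Complex.norm_real, Real.norm_of_nonneg hΨ.le,
        le_inv_mul_iff₀ hΨ]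
      exact h1
    · intro r
      have h1 := (hx (s + Ψ⁻¹ * r)).scomp r
        (((hasDerivAt_id r).const_mul Ψ⁻¹).const_add s)
      have h2 : ((Ψ⁻¹ : ℂ) • A) (x (s + Ψ⁻¹ * r)) = (Ψ⁻¹ * 1) • A (x (s + Ψ⁻¹ * r)) := by
        rw [mul_one, smul_apply, ← Complex.ofReal_inv, Complex.coe_smul]
      rw [h2]
      exact h1
    · intro a b hab
      exact hE (by gcongr)
  have iter : ∀ n : ℕ, E (x (n * (L / Ψ))) ≤ E (x 0) / 2 ^ n := by
    intro n
    induction n with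
    | zero => simp
    | succ n ih =>
      have h1 := step (n * (L / Ψ))
      push_cast
      rw [add_one_mul, pow_succ, ← div_div]
      exact h1.trans (by gcongr)
  -- Only complete half-lives are counted; the factor `2` in the conclusion pays for the incomplete
  -- last one.
  set n := ⌊t * Ψ / L⌋₊ with hn
  have hn1 : (n : ℝ) ≤ t * Ψ / L := Nat.floor_le (by positivity)
  have hn2 : t * Ψ / L < n + 1 := Nat.lt_floor_add_one _
  have h1 : (n : ℝ) * (L / Ψ) ≤ t := by
    calc (n : ℝ) * (L / Ψ) ≤ t * Ψ / L * (L / Ψ) := by gcongr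
      _ = t := by field_simp
  refine (hE h1).trans ((iter n).trans ?_)
  have h2 : (1 : ℝ) / 2 ^ n ≤ 2 * Real.exp (-(Real.log 2 / L) * Ψ * t) := by
    have h3 : Real.exp (-(Real.log 2 * (n + 1))) = (1 / 2) * (1 / 2 ^ n) := by
      rw [Real.exp_neg, Real.exp_mul, Real.exp_log two_pos, Real.rpow_add_one two_ne_zero,
        Real.rpow_natCast]
      field_simp
    calc (1 : ℝ) / 2 ^ n = 2 * Real.exp (-(Real.log 2 * (n + 1))) := by rw [h3]; ring
      _ ≤ 2 * Real.exp (-(Real.log 2 * (t * Ψ / L))) := by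
        have := Real.log_pos one_lt_two
        gcongr
      _ = _ := by ring_nf
  calc E (x 0) / 2 ^ n = 1 / 2 ^ n * E (x 0) := by ring
    _ ≤ _ := mul_le_mul_of_nonneg_right h2 (hE0 _)

end Gearhart

end LaminatedBeam

end

noncomputable section

namespace LaminatedBeam

/-! ### The linear flow -/

section Flow

open Filter Topology

variable {X : Type*} [NormedAddCommGroup X] [NormedSpace ℂ X] [CompleteSpace X]

theorem hasDerivAt_exp_apply (A : X →L[ℂ] X) (x₀ : X) (t : ℝ) :
    HasDerivAt (fun s : ℝ => NormedSpace.exp (s • A) x₀) (A (NormedSpace.exp (t • A) x₀)) t := by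
  have h := hasDerivAt_exp_smul_const' (𝕂 := ℝ) A t
  exact ((ContinuousLinearMap.apply ℂ X x₀).restrictScalars ℝ).hasFDerivAt.comp_hasDerivAt t h

omit [CompleteSpace X] in
theorem exp_zero_smul_apply (A : X →L[ℂ] X) (x₀ : X) :
    NormedSpace.exp ((0 : ℝ) • A) x₀ = x₀ := by
  simp

/-- Uniqueness for linear evolution equations with a bounded generator. -/
theorem eq_exp_apply {A : X →L[ℂ] X} {W : ℝ → X} (hc : ContinuousOn W (Ici 0))
    (hW : ∀ t, 0 < t → HasDerivAt W (A (W t)) t) {t : ℝ} (ht : 0 ≤ t) :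
    W t = NormedSpace.exp (t • A) (W 0) := by
  have := ODE_solution_unique (v := fun _ => A) (K := ‖A‖₊) (a := 0) (b := t) (f := W)
    (g := fun s => NormedSpace.exp (s • A) (W 0)) (fun _ => A.lipschitz)
    (hc.mono Icc_subset_Ici_self)
    (fun s hs => ?_) 
    (fun s _ => (hasDerivAt_exp_apply A (W 0) s).continuousAt.continuousWithinAt)
    (fun s _ => (hasDerivAt_exp_apply A (W 0) s).hasDerivWithinAt) ?_
  · exact this (right_mem_Icc.2 ht)
  -- No derivative is assumed at time zero. The right derivative there is recovered as the limit of
  -- the derivatives, by continuity of `W`.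
  · rcases hs.1.eq_or_lt with rfl | h0
    · refine hasDerivWithinAt_Ici_of_tendsto_deriv (s := Ioi 0)
        (fun s hs => (hW s hs).differentiableAt.differentiableWithinAt)
        ((hc 0 self_mem_Ici).mono Ioi_subset_Ici_self) self_mem_nhdsWithin ?_
      have h1 : Tendsto (fun s => A (W s)) (𝓝[>] 0) (𝓝 (A (W 0))) :=
        (A.continuous.tendsto _).comp ((hc 0 self_mem_Ici).mono Ioi_subset_Ici_self)
      refine h1.congr' ?_
      filter_upwards [self_mem_nhdsWithin] with s hs
      exact (hW s hs).deriv.symm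
    · exact (hW s h0).hasDerivWithinAt
  · simp

end Flow

/-! ### Pointwise decay in Fourier space -/

section Pointwise

variable {k₁ k₂ k₃ k₄ k₅ γ : ℝ}

theorem exists_energy_equiv (hk₁ : 0 < k₁) (hk₂ : 0 < k₂) (hk₃ : 0 < k₃) (hk₄ : 0 < k₄) :
    ∃ m M : ℝ, 0 < m ∧ 0 < M ∧ ∀ x : State, m * ‖x‖ ^ 2 ≤ energy k₁ k₂ k₃ k₄ x ∧
      energy k₁ k₂ k₃ k₄ x ≤ M * ‖x‖ ^ 2 := by
  set m := min 1 (min (min k₁ k₂) (min k₃ k₄)) with hm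
  have h0 : m ≤ 1 := min_le_left _ _
  have h1 : m ≤ k₁ := (min_le_right _ _).trans ((min_le_left _ _).trans (min_le_left _ _))
  have h2 : m ≤ k₂ := (min_le_right _ _).trans ((min_le_left _ _).trans (min_le_right _ _))
  have h3 : m ≤ k₃ := (min_le_right _ _).trans ((min_le_right _ _).trans (min_le_left _ _))
  have h4 : m ≤ k₄ := (min_le_right _ _).trans ((min_le_right _ _).trans (min_le_right _ _))
  refine ⟨m, 1 + k₁ + k₂ + k₃ + k₄, by positivity, by positivity, fun x => ?_⟩
  have key : ∀ {a b : ℝ} (i : Fin 8), a ≤ b → a * ‖x i‖ ^ 2 ≤ b * ‖x i‖ ^ 2 := fun i h =>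
    mul_le_mul_of_nonneg_right h (sq_nonneg _)
  rw [EuclideanSpace.norm_sq_eq, Fin.sum_univ_eight, energy]
  constructor
  · linarith [key 0 h1, key 1 h0, key 2 h2, key 3 h0, key 4 h3, key 5 h0, key 6 h4, key 7 h0]
  · set M := 1 + k₁ + k₂ + k₃ + k₄ with hM
    have g0 : 1 ≤ M := by linarith
    have g1 : k₁ ≤ M := by linarith
    have g2 : k₂ ≤ M := by linarith
    have g3 : k₃ ≤ M := by linarith
    have g4 : k₄ ≤ M := by linarith
    linarith [key 0 g1, key 1 g0, key 2 g2, key 3 g0, key 4 g3, key 5 g0, key 6 g4, key 7 g0]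

theorem hasDerivAt_energy {x : ℝ → State} {x' : State} {t : ℝ} (hx : HasDerivAt x x' t) :
    HasDerivAt (fun s => energy k₁ k₂ k₃ k₄ (x s)) (2 * energyPairing k₁ k₂ k₃ k₄ (x t) x') t := by
  have hi : ∀ i : Fin 8, HasDerivAt (fun s => ‖x s i‖ ^ 2)
      (2 * (starRingEnd ℂ (x t i) * x' i).re) t := by
    intro i
    have h1 : HasDerivAt (fun s => x s i) (x' i) t :=
      ((EuclideanSpace.proj i : State →L[ℂ] ℂ).restrictScalars ℝ).hasFDerivAt.comp_hasDerivAt t hx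
    have h2 := h1.norm_sq
    rw [Complex.inner] at h2
    rwa [mul_comm (x' i)] at h2
  have h := (((((((((hi 0).const_mul k₁).add (hi 1)).add ((hi 2).const_mul k₂)).add (hi 3)).add
    ((hi 4).const_mul k₃)).add (hi 5)).add ((hi 6).const_mul k₄)).add (hi 7))
  refine h.congr_deriv ?_
  simp [energyPairing]
  ring

/-- The constants of the decay theorem depend only on the energy equivalence, and the resolvent
constant does not depend on `ξ`. Hence the rate is uniform in frequency. -/
theorem exists_flow_decay (hk₁ : 0 < k₁) (hk₂ : 0 < k₂) (hk₃ : 0 < k₃) (hk₄ : 0 < k₄)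
    (hk₅ : 0 < k₅) (hγ : γ ≠ 0) (hχ : k₃ - k₂ ≠ 0) (d : HeatDissipation) :
    ∃ c : ℝ, 0 < c ∧ ∃ c' : ℝ, 0 < c' ∧ ∀ (ξ : ℝ) (x₀ : State) (t : ℝ), 0 ≤ t →
      ‖NormedSpace.exp (t • symbol (transversal k₁ k₂ k₃ k₄ k₅ γ) d ξ) x₀‖ ^ 2
        ≤ c' * Real.exp (-c * weight d ξ * t) * ‖x₀‖ ^ 2 := by
  obtain ⟨m, M, hm, hM, hE⟩ := exists_energy_equiv hk₁ hk₂ hk₃ hk₄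
  obtain ⟨c, hc, hdecay⟩ := exists_exp_decay (H := State) hm hM
  obtain ⟨r, hr, hres⟩ := exists_resolvent_bound hk₁ hk₂ hk₃ hk₄ hk₅ hγ hχ d
  refine ⟨c * r, by positivity, 2 * M / m, by positivity, fun ξ x₀ t ht => ?_⟩
  set A := symbol (transversal k₁ k₂ k₃ k₄ k₅ γ) d ξ with hA
  have hx := hasDerivAt_exp_apply A x₀
  have hanti : Antitone fun t : ℝ => energy k₁ k₂ k₃ k₄ (NormedSpace.exp (t • A) x₀) := by
    refine antitone_of_hasDerivAt_nonpos (fun t => hasDerivAt_energy (hx t)) fun t => ?_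
    rw [hA, energyPairing_symbol]
    have : 0 ≤ damping k₅ d ξ := by cases d <;> simp only [damping] <;> positivity
    have : 0 ≤ damping k₅ d ξ * ‖NormedSpace.exp
      (t • symbol (transversal k₁ k₂ k₃ k₄ k₅ γ) d ξ) x₀ 7‖ ^ 2 := by positivity
    simp only [Pi.zero_apply]
    linarith
  have h := hdecay A _ (energy k₁ k₂ k₃ k₄) (r * weight d ξ)
    (mul_nonneg hr.le (weight_nonneg d ξ)) (hres ξ) hx (fun w => (hE w).1) (fun w => (hE w).2)
    hanti t ht
  have h0 : NormedSpace.exp ((0 : ℝ) • A) x₀ = x₀ := exp_zero_smul_apply A x₀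
  simp only [h0] at h
  set e := Real.exp (-c * (r * weight d ξ) * t) with he
  have he' : Real.exp (-(c * r) * weight d ξ * t) = e := by rw [he]; ring_nf
  rw [he']
  refine le_of_mul_le_mul_left ?_ hm
  calc m * ‖NormedSpace.exp (t • A) x₀‖ ^ 2 ≤ 2 * e * energy k₁ k₂ k₃ k₄ x₀ := (hE _).1.trans h
    _ ≤ 2 * e * (M * ‖x₀‖ ^ 2) := mul_le_mul_of_nonneg_left (hE x₀).2 (by positivity)
    _ = m * (2 * M / m * e * ‖x₀‖ ^ 2) := by field_simp

theorem fourier_decay (hk₁ : 0 < k₁) (hk₂ : 0 < k₂) (hk₃ : 0 < k₃) (hk₄ : 0 < k₄)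
    (hk₅ : 0 < k₅) (hγ : γ ≠ 0) (hχ : k₃ - k₂ ≠ 0) (d : HeatDissipation) :
    ∃ c : ℝ, 0 < c ∧ ∃ c' : ℝ, 0 < c' ∧ ∀ (ξ : ℝ) (V : ℝ → State),
      IsFourierSolution (transversal k₁ k₂ k₃ k₄ k₅ γ) d ξ V → ∀ t : ℝ, 0 ≤ t →
        ‖V t‖ ^ 2 ≤ c' * Real.exp (-c * weight d ξ * t) * ‖V 0‖ ^ 2 := by
  obtain ⟨c, hc, c', hc', h⟩ := exists_flow_decay hk₁ hk₂ hk₃ hk₄ hk₅ hγ hχ d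
  refine ⟨c, hc, c', hc', fun ξ V hV t ht => ?_⟩
  rw [eq_exp_apply (A := symbol (transversal k₁ k₂ k₃ k₄ k₅ γ) d ξ) hV.continuousOn
    (fun s hs => (hV.equation s hs).congr_deriv ?_) ht]
  · exact h ξ (V 0) t ht
  · simp only [symbol, sub_apply, smul_apply]
    abel

end Pointwise

end LaminatedBeam

end

noncomputable section

namespace LaminatedBeam

/-! ### Weak solutions in Fourier space -/

section WeakToStrong

open Filter Topology

variable {X Y : Type*} [NormedAddCommGroup X] [NormedSpace ℝ X] [CompleteSpace X]
  [NormedAddCommGroup Y] [NormedSpace ℝ Y] [CompleteSpace Y]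

/-- A function whose weak derivative, tested against a separating family of functionals, is
continuous is differentiable. -/
theorem hasDerivAt_of_weak {ι : Type*} {φ : ι → X →L[ℝ] Y} {W G : ℝ → X}
    (hφ : ∀ x, (∀ i, φ i x = 0) → x = 0) (hG : ContinuousOn G (Ioi 0))
    (hW : ∀ i t, 0 < t → HasDerivAt (fun s => φ i (W s)) (φ i (G t)) t) {t : ℝ} (ht : 0 < t) :
    HasDerivAt W (G t) t := by
  have hsub : ∀ {s}, 0 < s → uIcc (t / 2) s ⊆ Ioi 0 := fun {s} hs r hr =>
    lt_of_lt_of_le (lt_min (half_pos ht) hs) hr.1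
  have hint : ∀ {s}, 0 < s → IntervalIntegrable G volume (t / 2) s := fun hs =>
    (hG.mono (hsub hs)).intervalIntegrable
  -- The fundamental theorem of calculus holds after applying each functional, and the functionals
  -- separate points. Starting from `t / 2` keeps the interval inside `(0, ∞)`.
  have hrep : ∀ s, 0 < s → W s = W (t / 2) + ∫ r in (t / 2)..s, G r := by
    intro s hs
    rw [← sub_eq_zero]
    refine hφ _ fun i => ?_
    rw [map_sub, map_add, ← (φ i).intervalIntegral_comp_comm (hint hs),
      intervalIntegral.integral_eq_sub_of_hasDerivAt (fun r hr => hW i r (hsub hs hr))]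
    · abel
    · exact ((φ i).continuous.comp_continuousOn (hG.mono (hsub hs))).intervalIntegrable
  have hd := (intervalIntegral.integral_hasDerivAt_right (hint ht)
    (hG.stronglyMeasurableAtFilter isOpen_Ioi t ht)
    (hG.continuousAt (Ioi_mem_nhds ht))).const_add (W (t / 2))
  refine hd.congr_of_eventuallyEq ?_
  filter_upwards [Ioi_mem_nhds ht] with s hs using hrep s hs

end WeakToStrong

/-! ### Multiplication operators on `L²` and their exponentials. -/

section Multiplication

open BoundedContinuousFunction ENNReal

theorem memLp_symbol_apply (f : ℝ →ᵇ (State →L[ℂ] State)) (g : StateL2) :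
    MemLp (fun ζ => f ζ (g ζ)) 2 volume :=
  (Lp.memLp g).of_le_mul (c := ‖f‖)
    (isBoundedBilinearMap_apply.continuous.comp_aestronglyMeasurable
      (f.continuous.aestronglyMeasurable.prodMk (Lp.aestronglyMeasurable g)))
    (Filter.Eventually.of_forall fun ζ => ((f ζ).le_opNorm _).trans
      (mul_le_mul_of_nonneg_right (f.norm_coe_le_norm ζ) (norm_nonneg _)))

/-- Multiplication of `L²` functions by a bounded continuous matrix symbol. -/
def mulOp (f : ℝ →ᵇ (State →L[ℂ] State)) : StateL2 →L[ℂ] StateL2 :=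
  LinearMap.mkContinuous
    { toFun := fun g => (memLp_symbol_apply f g).toLp
      map_add' := fun g g' => by
        ext1
        filter_upwards [(memLp_symbol_apply f (g + g')).coeFn_toLp,
          (memLp_symbol_apply f g).coeFn_toLp, (memLp_symbol_apply f g').coeFn_toLp,
          Lp.coeFn_add (memLp_symbol_apply f g).toLp (memLp_symbol_apply f g').toLp,
          Lp.coeFn_add g g'] with ζ h1 h2 h3 h4 h5
        rw [h1, h4, Pi.add_apply, h2, h3, h5, Pi.add_apply, map_add]
      map_smul' := fun c g => by
        ext1
        filter_upwards [(memLp_symbol_apply f (c • g)).coeFn_toLp,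
          (memLp_symbol_apply f g).coeFn_toLp, Lp.coeFn_smul c (memLp_symbol_apply f g).toLp,
          Lp.coeFn_smul c g] with ζ h1 h2 h3 h4
        rw [RingHom.id_apply, h1, h3, Pi.smul_apply, h2, h4, Pi.smul_apply, map_smul] }
    ‖f‖ fun g => by
      refine Lp.norm_le_mul_norm_of_ae_le_mul ?_
      filter_upwards [(memLp_symbol_apply f g).coeFn_toLp] with ζ h1
      simp only [LinearMap.coe_mk, AddHom.coe_mk, h1]
      exact ((f ζ).le_opNorm _).trans
        (mul_le_mul_of_nonneg_right (f.norm_coe_le_norm ζ) (norm_nonneg _))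

theorem coeFn_mulOp (f : ℝ →ᵇ (State →L[ℂ] State)) (g : StateL2) :
    mulOp f g =ᵐ[volume] fun ζ => f ζ (g ζ) :=
  (memLp_symbol_apply f g).coeFn_toLp

/-- `mulOp` as a ring homomorphism. -/
def mulOpHom : (ℝ →ᵇ (State →L[ℂ] State)) →+* (StateL2 →L[ℂ] StateL2) where
  toFun := mulOp
  map_one' := by
    ext1 g; ext1
    filter_upwards [coeFn_mulOp 1 g] with ζ h1
    rw [h1]; rfl
  map_mul' f f' := by
    ext1 g; ext1
    filter_upwards [coeFn_mulOp (f * f') g, coeFn_mulOp f (mulOp f' g), coeFn_mulOp f' g]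
      with ζ h1 h2 h3
    change _ = mulOp f (mulOp f' g) ζ
    rw [h1, h2, h3]; rfl
  map_zero' := by
    ext1 g; ext1
    filter_upwards [coeFn_mulOp 0 g, Lp.coeFn_zero State 2 (volume : Measure ℝ)] with ζ h1 h2
    change _ = (0 : StateL2) ζ
    rw [h1, h2]; rfl
  map_add' f f' := by
    ext1 g; ext1
    filter_upwards [coeFn_mulOp (f + f') g, coeFn_mulOp f g, coeFn_mulOp f' g,
      Lp.coeFn_add (mulOp f g) (mulOp f' g)] with ζ h1 h2 h3 h4
    change _ = (mulOp f g + mulOp f' g) ζ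
    rw [h1, h4, Pi.add_apply, h2, h3]; rfl

theorem norm_mulOp_le (f : ℝ →ᵇ (State →L[ℂ] State)) : ‖mulOp f‖ ≤ ‖f‖ :=
  LinearMap.mkContinuous_norm_le _ (norm_nonneg f) _

theorem continuous_mulOpHom : Continuous mulOpHom :=
  AddMonoidHomClass.continuous_of_bound mulOpHom 1 fun f => by
    rw [one_mul]; exact norm_mulOp_le f

/-- The exponential of a bounded continuous symbol is computed pointwise. -/
theorem exists_exp_symbol {𝔸 𝔹 : Type*} [NormedRing 𝔸] [NormedAlgebra ℂ 𝔸] [CompleteSpace 𝔸]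
    [NormedRing 𝔹] [NormedAlgebra ℂ 𝔹] (φ : (ℝ →ᵇ 𝔸) →+* 𝔹) (hφ : Continuous φ) (f : ℝ →ᵇ 𝔸) :
    ∃ F : ℝ →ᵇ 𝔸, (∀ ζ, F ζ = NormedSpace.exp (f ζ)) ∧ φ F = NormedSpace.exp (φ f) := by
  -- The exponential is taken in the Banach algebra of bounded continuous functions. Both `φ` and
  -- evaluation at a point are continuous ring homomorphisms, hence commute with it.
  refine ⟨NormedSpace.exp f, fun ζ => ?_,
    NormedSpace.map_exp_of_mem_ball (𝕂 := ℂ) φ hφ f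
      ((NormedSpace.expSeries_radius_eq_top ℂ (ℝ →ᵇ 𝔸)).symm ▸ edist_lt_top _ _)⟩
  let ev : (ℝ →ᵇ 𝔸) →+* 𝔸 :=
    { toFun := fun f => f ζ, map_one' := rfl, map_mul' := fun _ _ => rfl, map_zero' := rfl,
      map_add' := fun _ _ => rfl }
  exact NormedSpace.map_exp_of_mem_ball (𝕂 := ℂ) ev (continuous_eval_const ζ) f
      ((NormedSpace.expSeries_radius_eq_top ℂ (ℝ →ᵇ 𝔸)).symm ▸ edist_lt_top _ _)

theorem exp_smul_mulOp (t : ℝ) (f : ℝ →ᵇ (State →L[ℂ] State)) (g : StateL2) :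
    NormedSpace.exp (t • mulOp f) g =ᵐ[volume] fun ζ => NormedSpace.exp (t • f ζ) (g ζ) := by
  obtain ⟨F, hF, hφ⟩ := exists_exp_symbol (𝔸 := State →L[ℂ] State)
    (𝔹 := StateL2 →L[ℂ] StateL2) mulOpHom continuous_mulOpHom (t • f)
  have h2 : mulOpHom (t • f) = t • mulOp f := by
    ext1 g; ext1
    filter_upwards [coeFn_mulOp (t • f) g, coeFn_mulOp f g, Lp.coeFn_smul t (mulOp f g)]
      with ζ h1 h2 h3
    change mulOp (t • f) g ζ = (t • mulOp f g) ζ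
    rw [h1, h3, Pi.smul_apply, h2]; rfl
  rw [h2] at hφ
  filter_upwards [coeFn_mulOp F g] with ζ h4
  rw [← hφ]
  change mulOp F g ζ = _
  rw [h4, hF]; rfl

end Multiplication

end LaminatedBeam

end

noncomputable section

namespace LaminatedBeam

/-! ### The equation on the Fourier side and the representation of weak solutions. -/

section FourierSide

open FourierTransform TemperedDistribution BoundedContinuousFunction LineDeriv

/-- The Fourier multiplier of `∂ₓʲ`. -/
def derivSymbol (j : ℕ) (ζ : ℝ) : ℂ := (2 * Real.pi * Complex.I * ζ) ^ j

theorem hasTemperateGrowth_derivSymbol (j : ℕ) : (derivSymbol j).HasTemperateGrowth := by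
  have : (fun ζ : ℝ => (2 * Real.pi * Complex.I * ζ : ℂ)).HasTemperateGrowth := by fun_prop
  exact this.pow j

theorem derivCLM_eq_lineDerivOp (T : 𝓢'(ℝ, State)) :
    TemperedDistribution.derivCLM State T = ∂_{(1 : ℝ)} T := by
  ext1 g
  rw [derivCLM_apply_apply, lineDerivOp_apply_apply]
  congr 2

theorem fourier_derivCLM_iterate (j : ℕ) (T : 𝓢'(ℝ, State)) :
    𝓕 ((TemperedDistribution.derivCLM State)^[j] T)
      = smulLeftCLM State (derivSymbol j) (𝓕 T) := by
  induction j with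
  | zero =>
    have : derivSymbol 0 = fun _ => 1 := by ext; simp [derivSymbol]
    simp [this]
  | succ j ih =>
    rw [Function.iterate_succ_apply', derivCLM_eq_lineDerivOp, fourier_lineDerivOp_eq, ih,
      smulLeftCLM_smulLeftCLM_apply (hasTemperateGrowth_derivSymbol j) (by fun_prop)]
    have h1 : (derivSymbol (j + 1)) = (2 * Real.pi * Complex.I : ℂ) •
        (derivSymbol j * fun ζ : ℝ => ((inner ℝ ζ 1 : ℝ) : ℂ)) := by
      ext ζ
      simp [derivSymbol, pow_succ]
      ring
    rw [h1, smulLeftCLM_smul ((hasTemperateGrowth_derivSymbol j).mul (by fun_prop))]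
    rfl

theorem integrable_schwartz_smul (h : 𝓢(ℝ, ℂ)) (f : StateL2) :
    Integrable (fun ζ => h ζ • f ζ) :=
  memLp_one_iff_integrable.1 ((Lp.memLp f).smul (h.memLp 2))

/-- Two `L²` functions with the same weak integrals agree. -/
theorem eq_of_toTemperedDistribution_eq {f g : StateL2}
    (h : (f : 𝓢'(ℝ, State)) = (g : 𝓢'(ℝ, State))) : f = g := by
  have := LinearMap.ker_eq_bot.1
    (Lp.ker_toTemperedDistributionCLM_eq_bot (F := State) (μ := (volume : Measure ℝ)) (p := 2))
  exact this h

theorem derivCLM_iterate_apply_fourier (j : ℕ) (f : StateL2) (h : 𝓢(ℝ, ℂ)) :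
    (TemperedDistribution.derivCLM State)^[j] (f : 𝓢'(ℝ, State)) (𝓕 h)
      = ∫ ζ, h ζ • derivSymbol j ζ • (𝓕 f : StateL2) ζ := by
  rw [← TemperedDistribution.fourier_apply, fourier_derivCLM_iterate, Lp.fourier_toTemperedDistribution_eq,
    smulLeftCLM_apply_apply, Lp.toTemperedDistribution_apply]
  refine integral_congr_ae (Filter.Eventually.of_forall fun ζ => ?_)
  simp only
  rw [SchwartzMap.smulLeftCLM_apply_apply (hasTemperateGrowth_derivSymbol j), smul_smul,
    smul_eq_mul, mul_comm]

theorem integrable_derivSymbol_smul (j : ℕ) (f : StateL2) (h : 𝓢(ℝ, ℂ)) :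
    Integrable fun ζ => h ζ • derivSymbol j ζ • f ζ := by
  refine (integrable_schwartz_smul (SchwartzMap.smulLeftCLM ℂ (derivSymbol j) h) f).congr
    (Filter.Eventually.of_forall fun ζ => ?_)
  simp only
  rw [SchwartzMap.smulLeftCLM_apply_apply (hasTemperateGrowth_derivSymbol j), smul_smul,
    smul_eq_mul, mul_comm]

theorem integral_act (A : Matrix (Fin 8) (Fin 8) ℝ) (j : ℕ) (f : StateL2) (h : 𝓢(ℝ, ℂ)) :
    act A (∫ ζ, h ζ • derivSymbol j ζ • f ζ) = ∫ ζ, h ζ • derivSymbol j ζ • act A (f ζ) := by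
  rw [← (act A).integral_comp_comm (integrable_derivSymbol_smul j f h)]
  simp only [map_smul]

theorem integrable_act (A : Matrix (Fin 8) (Fin 8) ℝ) (j : ℕ) (f : StateL2) (h : 𝓢(ℝ, ℂ)) :
    Integrable fun ζ => h ζ • derivSymbol j ζ • act A (f ζ) := by
  simpa only [map_smul] using (act A).integrable_comp (integrable_derivSymbol_smul j f h)

/-- Testing the equation with `𝓕 h` moves the transform onto the solution. The normalisation of `𝓕`
makes the physical frequency `ξ = 2πζ`. -/
theorem IsSolution.hasDerivAt_fourier {p : Coefficients} {d : HeatDissipation} {U₀ : StateL2}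
    {U : ℝ → StateL2} (hU : IsSolution p d U₀ U) (h : 𝓢(ℝ, ℂ)) {t : ℝ} (ht : 0 < t) :
    HasDerivAt (fun s => ∫ ζ, h ζ • (𝓕 (U s) : StateL2) ζ)
      (∫ ζ, h ζ • symbol p d (2 * Real.pi * ζ) ((𝓕 (U t) : StateL2) ζ)) t := by
  have h0 := hU.equation (𝓕 h) t ht
  have h1 : (fun s => ((U s : StateL2) : 𝓢'(ℝ, State)) (𝓕 h))
      = fun s => ∫ ζ, h ζ • (𝓕 (U s) : StateL2) ζ := by
    ext1 s
    have := derivCLM_iterate_apply_fourier 0 (U s) h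
    simpa [derivSymbol] using this
  rw [h1] at h0
  refine h0.congr_deriv ?_
  have e0 := derivCLM_iterate_apply_fourier 0 (U t) h
  have e1 := derivCLM_iterate_apply_fourier 1 (U t) h
  have e2 := derivCLM_iterate_apply_fourier 2 (U t) h
  rw [Function.iterate_zero, id] at e0
  rw [Function.iterate_one] at e1
  rw [e0, e1, e2, integral_act, integral_act, integral_act,
    ← integral_add (integrable_act _ _ _ _) (integrable_act _ _ _ _),
    ← integral_add (f := fun ζ => h ζ • derivSymbol 2 ζ • act (matA₂ p d) ((𝓕 (U t) : StateL2) ζ)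
      + h ζ • derivSymbol 1 ζ • act (matA₁ p) ((𝓕 (U t) : StateL2) ζ))
      ((integrable_act _ _ _ _).add (integrable_act _ _ _ _)) (integrable_act _ _ _ _),
    ← integral_neg]
  refine integral_congr_ae (Filter.Eventually.of_forall fun ζ => ?_)
  simp only [symbol, _root_.sub_apply, _root_.smul_apply, derivSymbol, pow_zero, one_smul, pow_one]
  rw [← smul_add, ← smul_add, ← smul_neg]
  congr 1
  have hI : (2 * Real.pi * Complex.I * ζ : ℂ) ^ 2 = -((2 * Real.pi * ζ : ℝ) : ℂ) ^ 2 := by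
    push_cast
    linear_combination (2 * Real.pi * ζ : ℂ) ^ 2 * Complex.I_sq
  have hI1 : (2 * Real.pi * Complex.I * ζ : ℂ) = Complex.I * ((2 * Real.pi * ζ : ℝ) : ℂ) := by
    push_cast
    ring
  rw [hI, hI1, neg_smul]
  abel

theorem continuous_symbol (p : Coefficients) (d : HeatDissipation) : Continuous (symbol p d) := by
  unfold symbol
  fun_prop

/-- Multiplication by a frequency cut-off. -/
def cutoffSymbol (κ : ContDiffBump (0 : ℝ)) : ℝ →ᵇ (State →L[ℂ] State) :=
  BoundedContinuousFunction.ofNormedAddCommGroup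
    (fun ζ => ((κ ζ : ℝ) : ℂ) • ContinuousLinearMap.id ℂ State)
    (by have := κ.continuous; fun_prop) 1 fun ζ => by
      rw [norm_smul, Complex.norm_real, Real.norm_of_nonneg κ.nonneg]
      exact mul_le_one₀ κ.le_one (norm_nonneg _) ContinuousLinearMap.norm_id_le

/-- The symbol, frozen outside the interval `[-R, R]`. -/
def clampedSymbol (p : Coefficients) (d : HeatDissipation) (R : ℝ) (hR : 0 ≤ R) :
    ℝ →ᵇ (State →L[ℂ] State) :=
  have hc : Continuous fun ζ : ℝ => symbol p d (2 * Real.pi * (projIcc (-R) R (by linarith) ζ)) :=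
    (continuous_symbol p d).comp
      (continuous_const.mul (continuous_subtype_val.comp continuous_projIcc))
  BoundedContinuousFunction.ofNormedAddCommGroup _ hc
    (isCompact_Icc.exists_bound_of_continuousOn (s := Icc (-R) R) hc.continuousOn).choose
    fun ζ => by
      have h := (isCompact_Icc.exists_bound_of_continuousOn (s := Icc (-R) R)
        hc.continuousOn).choose_spec (projIcc (-R) R (by linarith) ζ) (Subtype.coe_prop _)
      rwa [projIcc_val] at h

theorem clampedSymbol_apply (p : Coefficients) (d : HeatDissipation) {R : ℝ} (hR : 0 ≤ R) {ζ : ℝ}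
    (hζ : ζ ∈ Icc (-R) R) : clampedSymbol p d R hR ζ = symbol p d (2 * Real.pi * ζ) := by
  change symbol p d (2 * Real.pi * (projIcc (-R) R (by linarith) ζ)) = _
  rw [projIcc_of_mem _ hζ]

theorem coeFn_cutoff (κ : ContDiffBump (0 : ℝ)) (f : StateL2) :
    mulOp (cutoffSymbol κ) f =ᵐ[volume] fun ζ => ((κ ζ : ℝ) : ℂ) • f ζ :=
  coeFn_mulOp _ _

/-- Multiplication of a test function by a frequency cut-off. -/
theorem exists_cutoff_schwartz (κ : ContDiffBump (0 : ℝ)) (h : 𝓢(ℝ, ℂ)) :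
    ∃ g : 𝓢(ℝ, ℂ), ∀ ζ, g ζ = h ζ * ((κ ζ : ℝ) : ℂ) := by
  have hκ : (fun ζ => ((κ ζ : ℝ) : ℂ)).HasTemperateGrowth := by
    have h1 : HasCompactSupport fun ζ => ((κ ζ : ℝ) : ℂ) :=
      κ.hasCompactSupport.comp_left (g := fun r : ℝ => (r : ℂ)) Complex.ofReal_zero
    have h2 : ContDiff ℝ (⊤ : ℕ∞) fun ζ => ((κ ζ : ℝ) : ℂ) :=
      Complex.ofRealCLM.contDiff.comp κ.contDiff
    exact (h1.toSchwartzMap h2).hasTemperateGrowth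
  refine ⟨SchwartzMap.smulLeftCLM ℂ (fun ζ => ((κ ζ : ℝ) : ℂ)) h, fun ζ => ?_⟩
  rw [SchwartzMap.smulLeftCLM_apply_apply hκ, smul_eq_mul, mul_comm]

/-- Pairing of an `L²` function with a test function. -/
def testPairing (h : 𝓢(ℝ, ℂ)) : StateL2 →L[ℂ] State :=
  (PointwiseConvergenceCLM.evalCLM (RingHom.id ℂ) State h) ∘L
    (Lp.toTemperedDistributionCLM State (volume : Measure ℝ) 2)

theorem testPairing_apply (h : 𝓢(ℝ, ℂ)) (f : StateL2) :
    testPairing h f = ∫ ζ, h ζ • f ζ :=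
  Lp.toTemperedDistribution_apply f h

theorem eq_zero_of_testPairing {f : StateL2} (hf : ∀ h, testPairing h f = 0) : f = 0 := by
  apply eq_of_toTemperedDistribution_eq
  ext1 h
  exact (hf h).trans (map_zero (testPairing h)).symm

/-- In Fourier space a weak solution is given by the exponential of the symbol. -/
theorem IsSolution.fourier_ae {p : Coefficients} {d : HeatDissipation} {U₀ : StateL2}
    {U : ℝ → StateL2} (hU : IsSolution p d U₀ U) {t : ℝ} (ht : 0 ≤ t) :
    ∀ᵐ ζ : ℝ, (𝓕 (U t) : StateL2) ζ
      = NormedSpace.exp (t • symbol p d (2 * Real.pi * ζ)) ((𝓕 U₀ : StateL2) ζ) := by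
  have hn : ∀ n : ℕ, ∀ᵐ ζ : ℝ, ζ ∈ Icc (-(n + 1 : ℝ)) (n + 1) → (𝓕 (U t) : StateL2) ζ
      = NormedSpace.exp (t • symbol p d (2 * Real.pi * ζ)) ((𝓕 U₀ : StateL2) ζ) := by
    intro n
    -- The symbol is unbounded in frequency, so uniqueness for bounded generators is applied after
    -- localisation. The bump is `1` on `[-(n+1), n+1]` and vanishes outside `[-(n+2), n+2]`, where
    -- the clamped symbol is the true one.
    let κ : ContDiffBump (0 : ℝ) := ⟨n + 1, n + 2, by positivity, by linarith⟩
    have hR : (0 : ℝ) ≤ n + 2 := by positivity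
    set m := clampedSymbol p d (n + 2) hR
    set W : ℝ → StateL2 := fun s => mulOp (cutoffSymbol κ) (𝓕 (U s)) with hWdef
    have hWc : ContinuousOn W (Ici 0) :=
      (mulOp (cutoffSymbol κ)).continuous.comp_continuousOn
        ((Lp.fourierTransformₗᵢ ℝ State).continuous.comp_continuousOn hU.continuousOn)
    have hW : ∀ s, 0 < s → HasDerivAt W (mulOp m (W s)) s := by
      intro s hs
      refine hasDerivAt_of_weak (φ := fun h => (testPairing h).restrictScalars ℝ)
        (G := fun s => mulOp m (W s)) (fun f hf => eq_zero_of_testPairing hf)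
        ((mulOp m).continuous.comp_continuousOn (hWc.mono Ioi_subset_Ici_self))
        (fun h r hr => ?_) hs
      -- Moving the cut-off onto the test function gives the weak equation for `W`; the clamping is
      -- invisible because `W` vanishes where it acts.
      obtain ⟨g, hg⟩ := exists_cutoff_schwartz κ h
      have h1 := hU.hasDerivAt_fourier g hr
      have h2 : (fun s => ∫ ζ, g ζ • (𝓕 (U s) : StateL2) ζ)
          = fun s => (testPairing h).restrictScalars ℝ (W s) := by
        ext1 s
        rw [ContinuousLinearMap.coe_restrictScalars', testPairing_apply]
        refine integral_congr_ae ?_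
        filter_upwards [coeFn_cutoff κ (𝓕 (U s))] with ζ h3
        rw [hWdef]
        simp only [h3, hg, smul_smul]
      rw [h2] at h1
      refine h1.congr_deriv ?_
      rw [ContinuousLinearMap.coe_restrictScalars', testPairing_apply]
      refine integral_congr_ae ?_
      filter_upwards [coeFn_cutoff κ (𝓕 (U r)), coeFn_mulOp m (W r)] with ζ h3 h4
      rw [h4, hWdef]
      simp only [h3, hg, map_smul, smul_smul]
      by_cases hζ : ζ ∈ Icc (-(n + 2 : ℝ)) (n + 2)
      · rw [clampedSymbol_apply p d hR hζ]
      · have : κ ζ = 0 := by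
          refine κ.zero_of_le_dist ?_
          rw [Real.dist_eq, sub_zero]
          change (n + 2 : ℝ) ≤ |ζ|
          by_contra! hlt
          exact hζ ⟨(abs_lt.1 hlt).1.le, (abs_lt.1 hlt).2.le⟩
        simp [this]
    have hexp := eq_exp_apply hWc hW ht
    have h0 : W 0 = mulOp (cutoffSymbol κ) (𝓕 U₀) := by rw [hWdef]; simp only [hU.initial]
    rw [h0] at hexp
    filter_upwards [coeFn_cutoff κ (𝓕 (U t)), coeFn_cutoff κ (𝓕 U₀),
      exp_smul_mulOp t m (mulOp (cutoffSymbol κ) (𝓕 U₀))] with ζ h1 h2 h3 hζ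
    have hκ : κ ζ = 1 := by
      refine κ.one_of_mem_closedBall ?_
      rw [Real.closedBall_eq_Icc]
      simpa [κ] using hζ
    have hζ' : ζ ∈ Icc (-(n + 2 : ℝ)) (n + 2) := ⟨by linarith [hζ.1], by linarith [hζ.2]⟩
    have h4 := (congrArg (fun f : StateL2 => f ζ) hexp).trans h3
    rw [h2, hκ, clampedSymbol_apply p d hR hζ', hWdef] at h4
    simp only [h1, hκ, Complex.ofReal_one, one_smul] at h4
    exact h4
  filter_upwards [ae_all_iff.2 hn] with ζ h
  obtain ⟨n, hn⟩ := exists_nat_ge |ζ|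
  exact h n ⟨by linarith [(abs_le.1 hn).1], by linarith [(abs_le.1 hn).2]⟩

end FourierSide

end LaminatedBeam

end

noncomputable section

namespace LaminatedBeam

/-! ### Decay estimates in `L²` -/

section Estimates

open FourierTransform TemperedDistribution ENNReal

/-- The Fourier transform of an integrable `L²` function is bounded by the `L¹` norm. -/
theorem norm_fourier_le_integral_norm {f : StateL2} (hf : Integrable f (volume : Measure ℝ)) :
    ∀ᵐ ζ : ℝ, ‖(𝓕 f : StateL2) ζ‖ ≤ ∫ x : ℝ, ‖f x‖ := by
  have hc : Continuous (𝓕 (f : ℝ → State)) :=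
    VectorFourier.fourierIntegral_continuous Real.continuous_fourierChar continuous_inner hf
  -- The `L²` transform is defined by extension. Testing against smooth compactly supported
  -- functions identifies it with the Fourier integral, for which the bound is immediate.
  have key : (𝓕 f : StateL2) =ᵐ[volume] 𝓕 (f : ℝ → State) := by
    refine ae_eq_of_integral_contDiff_smul_eq
      ((Lp.memLp (𝓕 f : StateL2)).locallyIntegrable one_le_two) hc.locallyIntegrable
      fun g hg hgc => ?_
    have hg₁ : HasCompactSupport (Complex.ofRealCLM ∘ g) := hgc.comp_left rfl
    have hg₂ : ContDiff ℝ (⊤ : ℕ∞) (Complex.ofRealCLM ∘ g) := by fun_prop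
    set h : 𝓢(ℝ, ℂ) := hg₁.toSchwartzMap hg₂
    have h1 := derivCLM_iterate_apply_fourier 0 f h
    have h2 : ∫ ξ, (𝓕 h) ξ • f ξ = ∫ x, h x • 𝓕 (f : ℝ → State) x := by
      simpa using! VectorFourier.integral_fourierIntegral_smul_eq_flip (L := innerₗ ℝ)
        Real.continuous_fourierChar continuous_inner h.integrable hf
    simp only [Function.iterate_zero, id, Lp.toTemperedDistribution_apply, derivSymbol, pow_zero,
      one_smul] at h1
    have h3 := h1.symm.trans h2
    exact h3
  filter_upwards [key] with ζ h
  rw [h]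
  exact VectorFourier.norm_fourierIntegral_le_integral_norm _ _ _ _ _

theorem norm_derivSymbol (j : ℕ) (ζ : ℝ) : ‖derivSymbol j ζ‖ = |2 * Real.pi * ζ| ^ j := by
  simp [derivSymbol, abs_mul]

/-- The Fourier transform of a function in `H^N` has `j ≤ N` square integrable moments. -/
theorem memLp_derivSymbol_fourier {N j : ℕ} (hj : j ≤ N) {f : StateL2}
    (hf : MemSobolev (N : ℝ) 2 (f : 𝓢'(ℝ, State))) :
    MemLp (fun ζ => derivSymbol j ζ • (𝓕 f : StateL2) ζ) 2 (volume : Measure ℝ) := by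
  -- Here `u` is the `L²` function `(1 + ζ²)^(N/2) 𝓕 f`; since `j ≤ N`, its factor dominates `|ζ| ^
  -- j`.
  obtain ⟨u, hu⟩ := memSobolev_iff_exists_smulLeftCLM_fourier.mp hf
  have hle : ∀ ζ : ℝ, |ζ| ^ j * (1 + ‖ζ‖ ^ 2) ^ (-(N : ℝ) / 2) ≤ 1 := by
    intro ζ
    have h1 : (1 : ℝ) ≤ 1 + ‖ζ‖ ^ 2 := by nlinarith [sq_nonneg ‖ζ‖]
    have h2 : |ζ| ^ j ≤ (1 + ‖ζ‖ ^ 2) ^ ((N : ℝ) / 2) := by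
      calc |ζ| ^ j = (|ζ| ^ 2) ^ ((j : ℝ) / 2) := by
            rw [← Real.rpow_natCast _ 2, ← Real.rpow_mul (abs_nonneg _), ← Real.rpow_natCast]
            congr 1
            push_cast
            ring
        _ ≤ (1 + ‖ζ‖ ^ 2) ^ ((j : ℝ) / 2) := by
            refine Real.rpow_le_rpow (by positivity) ?_ (by positivity)
            rw [Real.norm_eq_abs]
            linarith
        _ ≤ _ := Real.rpow_le_rpow_of_exponent_le h1 (by gcongr)
    rw [neg_div, Real.rpow_neg (by positivity), ← div_eq_mul_inv]
    exact div_le_one_of_le₀ h2 (by positivity)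
  have hbd : ∀ ζ : ℝ, ‖(((1 + ‖ζ‖ ^ 2) ^ (-(N : ℝ) / 2) : ℝ) : ℂ)‖ ≤ 1 := by
    intro ζ
    rw [Complex.norm_real, Real.norm_of_nonneg (by positivity)]
    refine Real.rpow_le_one_of_one_le_of_nonpos (by nlinarith [sq_nonneg ‖ζ‖]) ?_
    have : (0 : ℝ) ≤ N := by positivity
    linarith
  have htg : (fun ζ : ℝ => (((1 + ‖ζ‖ ^ 2) ^ (-(N : ℝ) / 2) : ℝ) : ℂ)).HasTemperateGrowth := by
    fun_prop
  have hmem : MemLp (fun ζ : ℝ => (((1 + ‖ζ‖ ^ 2) ^ (-(N : ℝ) / 2) : ℝ) : ℂ)) ∞ volume :=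
    memLp_top_of_bound htg.1.continuous.aestronglyMeasurable 1 (Filter.Eventually.of_forall hbd)
  have hrep : (hmem.toLp _ • u : StateL2) = 𝓕 f := by
    apply eq_of_toTemperedDistribution_eq
    rw [Lp.toTemperedDistribution_smul_eq htg, ← hu,
      smulLeftCLM_smulLeftCLM_apply (by fun_prop) (by fun_prop),
      ← Lp.fourier_toTemperedDistribution_eq]
    convert! (smulLeftCLM_const 1 (𝓕 (f : 𝓢'(ℝ, State)))) using 1
    · congr
      ext x
      rw [Pi.mul_apply]
      rw [← Complex.ofReal_mul, ← Real.rpow_add (by positivity),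
        show (N : ℝ) / 2 + -(N : ℝ) / 2 = 0 by ring, Real.rpow_zero, Complex.ofReal_one]
    · simp
  have hae : (𝓕 f : StateL2) =ᵐ[volume]
      fun ζ => (((1 + ‖ζ‖ ^ 2) ^ (-(N : ℝ) / 2) : ℝ) : ℂ) • u ζ := by
    rw [← hrep]
    filter_upwards [Lp.coeFn_lpSMul (r := 2) (hmem.toLp _) u, hmem.coeFn_toLp] with ζ h1 h2
    rw [h1, Pi.smul_apply', h2]
  refine (Lp.memLp u).of_le_mul (c := (2 * Real.pi) ^ j)
    ((hasTemperateGrowth_derivSymbol j).1.continuous.aestronglyMeasurable.smul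
      (Lp.aestronglyMeasurable _)) ?_
  filter_upwards [hae] with ζ h1
  rw [h1, norm_smul, norm_smul, norm_derivSymbol, abs_mul, mul_pow,
    abs_of_pos Real.two_pi_pos, Complex.norm_real, Real.norm_of_nonneg (by positivity)]
  calc (2 * Real.pi) ^ j * |ζ| ^ j * ((1 + ‖ζ‖ ^ 2) ^ (-(N : ℝ) / 2) * ‖u ζ‖)
      = (2 * Real.pi) ^ j * (|ζ| ^ j * (1 + ‖ζ‖ ^ 2) ^ (-(N : ℝ) / 2)) * ‖u ζ‖ := by ring
    _ ≤ (2 * Real.pi) ^ j * 1 * ‖u ζ‖ := by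
      gcongr
      exact hle ζ
    _ = _ := by ring

/-- Existence of distributional derivatives in `L²`, through the Fourier transform. -/
theorem exists_isXDeriv {j : ℕ} {f : StateL2}
    (hf : MemLp (fun ζ => derivSymbol j ζ • (𝓕 f : StateL2) ζ) 2 (volume : Measure ℝ)) :
    ∃ g : StateL2, IsXDeriv j f g ∧
      (𝓕 g : StateL2) =ᵐ[volume] fun ζ => derivSymbol j ζ • (𝓕 f : StateL2) ζ := by
  refine ⟨𝓕⁻ (hf.toLp _), ?_, ?_⟩
  · have h1 : 𝓕 ((TemperedDistribution.derivCLM State)^[j] (f : 𝓢'(ℝ, State)))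
        = 𝓕 ((𝓕⁻ (hf.toLp _) : StateL2) : 𝓢'(ℝ, State)) := by
      rw [Lp.fourier_toTemperedDistribution_eq, FourierTransform.fourier_fourierInv_eq]
      ext1 h
      rw [TemperedDistribution.fourier_apply, derivCLM_iterate_apply_fourier,
        Lp.toTemperedDistribution_apply]
      refine integral_congr_ae ?_
      filter_upwards [hf.coeFn_toLp] with ζ h2
      rw [h2]
    have h2 := congrArg (fun T : 𝓢'(ℝ, State) => 𝓕⁻ T) h1
    simp only [FourierTransform.fourierInv_fourier_eq] at h2
    exact h2
  · rw [FourierTransform.fourier_fourierInv_eq]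
    exact hf.coeFn_toLp

theorem sq_norm_eq_integral_fourier (g : StateL2) :
    ‖g‖ ^ 2 = ∫ ζ, ‖(𝓕 g : StateL2) ζ‖ ^ 2 := by
  rw [← Lp.norm_fourier_eq g]
  have h := L2.inner_def (𝕜 := ℂ) (𝓕 g : StateL2) (𝓕 g)
  rw [inner_self_eq_norm_sq_to_K] at h
  simp only [inner_self_eq_norm_sq_to_K] at h
  apply Complex.ofReal_injective
  rw [← integral_complex_ofReal]
  push_cast
  exact h

/-- The scaling exponent `-(n + 1) / q` of `b` is the source of the algebraic decay rate, with `b`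
proportional to `1 + t`. -/
theorem integrable_abs_pow_mul_exp (n q : ℕ) (hq : 0 < q) {b : ℝ} (hb : 0 < b) :
    Integrable (fun x : ℝ => |x| ^ n * Real.exp (-b * |x| ^ q)) ∧
    ∫ x : ℝ, |x| ^ n * Real.exp (-b * |x| ^ q)
      = b ^ (-((n : ℝ) + 1) / q) * (2 / q * Real.Gamma (((n : ℝ) + 1) / q)) := by
  have hq' : (0 : ℝ) < q := Nat.cast_pos.2 hq
  have h1 : ∫ x : ℝ, |x| ^ n * Real.exp (-b * |x| ^ q)
      = b ^ (-((n : ℝ) + 1) / q) * (2 / q * Real.Gamma (((n : ℝ) + 1) / q)) := by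
    rw [integral_comp_abs (f := fun x => x ^ n * Real.exp (-b * x ^ q))]
    have h2 := integral_rpow_mul_exp_neg_mul_rpow (p := q) (q := n) hq'
      (by linarith [(Nat.cast_nonneg n : (0 : ℝ) ≤ n)]) hb
    simp only [Real.rpow_natCast] at h2
    rw [h2]
    ring
  refine ⟨?_, h1⟩
  -- A non-integrable function has Bochner integral zero, whereas the closed formula is positive.
  by_contra hni
  rw [integral_undef hni] at h1
  have := Real.Gamma_pos_of_pos (s := ((n : ℝ) + 1) / q) (by positivity)
  exact absurd h1 (by positivity)

/-- The order of vanishing of the weight at low frequencies. -/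
def lowOrder : HeatDissipation → ℕ
  | .strong => 6
  | .weak => 4

theorem lowOrder_pos (d : HeatDissipation) : 0 < lowOrder d := by
  cases d <;> simp [lowOrder]

/-- For `|ξ| ≤ 1` each of the at most five terms of the denominator is at most one. -/
theorem le_weight_of_abs_le_one (d : HeatDissipation) {ξ : ℝ} (hξ : |ξ| ≤ 1) :
    |ξ| ^ lowOrder d / 5 ≤ weight d ξ := by
  have h2 : ξ ^ 2 ≤ 1 := (sq_le_one_iff_abs_le_one ξ).2 hξ
  have h4 : ξ ^ 4 ≤ 1 := by nlinarith [sq_nonneg ξ]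
  have h6 : ξ ^ 6 ≤ 1 := by nlinarith [sq_nonneg ξ, sq_nonneg (ξ ^ 2)]
  have h8 : ξ ^ 8 ≤ 1 := by nlinarith [sq_nonneg (ξ ^ 4), sq_nonneg (ξ ^ 2)]
  cases d <;> simp only [lowOrder, weight]
  · rw [Even.pow_abs (by decide)]
    gcongr
    linarith
  · rw [Even.pow_abs (by decide)]
    gcongr
    linarith

theorem le_weight_of_one_le_abs (d : HeatDissipation) {ξ : ℝ} (hξ : 1 ≤ |ξ|) :
    1 / (5 * ξ ^ 2) ≤ weight d ξ := by
  have h2 : 1 ≤ ξ ^ 2 := (one_le_sq_iff_one_le_abs ξ).2 hξ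
  have h4 : ξ ^ 2 ≤ ξ ^ 4 := by nlinarith [sq_nonneg ξ]
  have h6 : ξ ^ 4 ≤ ξ ^ 6 := by nlinarith [sq_nonneg ξ, sq_nonneg (ξ ^ 2)]
  have h8 : ξ ^ 6 ≤ ξ ^ 8 := by nlinarith [sq_nonneg (ξ ^ 3), sq_nonneg (ξ ^ 2)]
  cases d <;> simp only [weight] <;> rw [div_le_div_iff₀ (by positivity) (by positivity)] <;>
    nlinarith

/-- The high frequency part: decay is traded against derivatives. -/
theorem exp_weight_le_of_one_le_abs {c : ℝ} (hc : 0 < c) (ℓ : ℕ) :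
    ∃ K : ℝ, 0 < K ∧ ∀ (d : HeatDissipation) (ξ t : ℝ), 1 ≤ |ξ| → 0 ≤ t →
      Real.exp (-c * weight d ξ * t) ≤ K * ((1 + t) ^ ℓ)⁻¹ * (ξ ^ 2) ^ ℓ := by
  -- The factor `exp (c / 5)` pays for replacing `t` by `1 + t`; the rest comes from `exp (-y) ≤ ℓ!
  -- / y ^ ℓ` with `y = (c / 5) (1 + t) / ξ²`.
  refine ⟨Real.exp (c / 5) * (ℓ.factorial * (5 / c) ^ ℓ), by positivity, fun d ξ t hξ ht => ?_⟩
  have h2 : 1 ≤ ξ ^ 2 := (one_le_sq_iff_one_le_abs ξ).2 hξ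
  have hξ0 : 0 < ξ ^ 2 := by linarith
  set s := (1 + t) / ξ ^ 2 with hs
  have hs0 : 0 < s := by positivity
  have h3 : Real.exp (-c * weight d ξ * t) ≤ Real.exp (c / 5) * Real.exp (-(c / 5 * s)) := by
    rw [← Real.exp_add]
    refine Real.exp_le_exp.2 ?_
    have h4 := mul_le_mul_of_nonneg_right (le_weight_of_one_le_abs d hξ) ht
    have h5 : 1 / (5 * ξ ^ 2) * t = (s - 1 / ξ ^ 2) / 5 := by
      rw [hs]
      field_simp
      ring
    have h6 : 1 / ξ ^ 2 ≤ 1 := (div_le_one hξ0).2 h2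
    nlinarith
  have h4 : (c / 5 * s) ^ ℓ * Real.exp (-(c / 5 * s)) ≤ ℓ.factorial := by
    have := Real.pow_div_factorial_le_exp (x := c / 5 * s) (by positivity) ℓ
    rw [div_le_iff₀ (by positivity)] at this
    rw [Real.exp_neg, ← div_eq_mul_inv, div_le_iff₀ (Real.exp_pos _)]
    exact this.trans_eq (mul_comm _ _)
  have h5 : Real.exp (-(c / 5 * s)) ≤ ℓ.factorial * (5 / c) ^ ℓ * (s ^ ℓ)⁻¹ := by
    have e1 : (c / 5 * s) ^ ℓ * ((5 / c) ^ ℓ * (s ^ ℓ)⁻¹) = 1 := by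
      rw [mul_pow, div_pow, div_pow]
      field_simp
      rw [← mul_pow, mul_div_cancel₀ _ hc.ne']
    calc Real.exp (-(c / 5 * s))
        = (c / 5 * s) ^ ℓ * Real.exp (-(c / 5 * s)) * ((5 / c) ^ ℓ * (s ^ ℓ)⁻¹) := by
          rw [mul_right_comm, e1, one_mul]
      _ ≤ ℓ.factorial * ((5 / c) ^ ℓ * (s ^ ℓ)⁻¹) := by gcongr
      _ = _ := by ring
  calc Real.exp (-c * weight d ξ * t) ≤ Real.exp (c / 5) * Real.exp (-(c / 5 * s)) := h3
    _ ≤ Real.exp (c / 5) * (ℓ.factorial * (5 / c) ^ ℓ * (s ^ ℓ)⁻¹) := by gcongr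
    _ = _ := by
      rw [hs, div_pow (1 + t), inv_div]
      ring

theorem exp_weight_le_of_abs_le_one {c : ℝ} (hc : 0 < c) (d : HeatDissipation) {ξ t : ℝ}
    (hξ : |ξ| ≤ 1) (ht : 0 ≤ t) : Real.exp (-c * weight d ξ * t)
      ≤ Real.exp (c / 5) * Real.exp (-(c / 5 * (1 + t)) * |ξ| ^ lowOrder d) := by
  rw [← Real.exp_add]
  refine Real.exp_le_exp.2 ?_
  have h1 := mul_le_mul_of_nonneg_right (le_weight_of_abs_le_one d hξ) ht
  have h2 : |ξ| ^ lowOrder d ≤ 1 := pow_le_one₀ (abs_nonneg _) hξ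
  nlinarith

end Estimates

/-! ### The decay estimate for solutions. -/

section Main

open FourierTransform TemperedDistribution ENNReal

variable {k₁ k₂ k₃ k₄ k₅ γ : ℝ}

theorem solution_decay (hk₁ : 0 < k₁) (hk₂ : 0 < k₂) (hk₃ : 0 < k₃) (hk₄ : 0 < k₄)
    (hk₅ : 0 < k₅) (hγ : γ ≠ 0) (hχ : k₃ - k₂ ≠ 0) (d : HeatDissipation) (N ℓ j : ℕ)
    (hj : j + ℓ ≤ N) :
    ∃ c₀ : ℝ, 0 < c₀ ∧ ∀ U₀ : StateL2, MemSobolev (N : ℝ) 2 (U₀ : 𝓢'(ℝ, State)) →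
      Integrable U₀ (volume : Measure ℝ) → ∀ U : ℝ → StateL2,
        IsSolution (transversal k₁ k₂ k₃ k₄ k₅ γ) d U₀ U → ∀ t : ℝ, 0 ≤ t →
          ∃ dU dU₀ : StateL2, IsXDeriv j (U t) dU ∧ IsXDeriv (j + ℓ) U₀ dU₀ ∧
            ‖dU‖ ≤ c₀ * (1 + t) ^ (-(2 * (j : ℝ) + 1) / (2 * lowOrder d)) * (∫ x : ℝ, ‖U₀ x‖)
              + c₀ * (1 + t) ^ (-(ℓ : ℝ) / 2) * ‖dU₀‖ := by
  obtain ⟨c, hc, c', hc', hflow⟩ := exists_flow_decay hk₁ hk₂ hk₃ hk₄ hk₅ hγ hχ d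
  obtain ⟨K, hK, hhigh⟩ := exp_weight_le_of_one_le_abs hc ℓ
  have hq : 0 < lowOrder d := lowOrder_pos d
  have hq' : (0 : ℝ) < lowOrder d := Nat.cast_pos.2 hq
  set r : ℝ := -(2 * (j : ℝ) + 1) / lowOrder d with hr
  set I : ℝ := 2 / lowOrder d * Real.Gamma ((2 * (j : ℝ) + 1) / lowOrder d) with hI
  have hI0 : 0 < I := mul_pos (by positivity) (Real.Gamma_pos_of_pos (by positivity))
  -- This is the low-frequency constant: the integral of `g (2πζ)` with the power `(1 + t) ^ r`
  -- taken out. The exponent `r` belongs to the squared norm and is halved at the end.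
  set C₁ : ℝ := c' * Real.exp (c / 5) * ((2 * Real.pi)⁻¹ * ((c / 5) ^ r * I)) with hC₁
  have hC₁0 : 0 < C₁ := by positivity
  set C₂ : ℝ := c' * K with hC₂
  have hC₂0 : 0 < C₂ := by positivity
  refine ⟨√C₁ + √C₂, by positivity, fun U₀ hS hL1 U hU t ht => ?_⟩
  set B := ∫ x : ℝ, ‖U₀ x‖ with hB
  have hB0 : 0 ≤ B := integral_nonneg fun _ => norm_nonneg _
  have ht1 : 0 < 1 + t := by linarith
  have hpt : ∀ᵐ ζ : ℝ, ‖(𝓕 (U t) : StateL2) ζ‖ ^ 2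
      ≤ c' * Real.exp (-c * weight d (2 * Real.pi * ζ) * t) * ‖(𝓕 U₀ : StateL2) ζ‖ ^ 2 := by
    filter_upwards [hU.fourier_ae ht] with ζ h
    rw [h]
    exact hflow _ _ t ht
  obtain ⟨dU₀, hdU₀, hF₀⟩ := exists_isXDeriv (memLp_derivSymbol_fourier hj hS)
  -- The flow is bounded uniformly in frequency, so the moments of the data persist and `∂ₓʲ U(t)`
  -- lies in `L²`.
  have hmem : MemLp (fun ζ => derivSymbol j ζ • (𝓕 (U t) : StateL2) ζ) 2
      (volume : Measure ℝ) := by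
    refine (memLp_derivSymbol_fourier (by omega : j ≤ N) hS).of_le_mul (c := √c')
      ((hasTemperateGrowth_derivSymbol j).1.continuous.aestronglyMeasurable.smul
        (Lp.aestronglyMeasurable _)) ?_
    filter_upwards [hpt] with ζ h
    rw [norm_smul, norm_smul, mul_left_comm]
    refine mul_le_mul_of_nonneg_left ?_ (norm_nonneg _)
    refine le_of_abs_le (abs_le_of_sq_le_sq (h.trans ?_) (by positivity))
    rw [mul_pow, Real.sq_sqrt hc'.le]
    refine mul_le_mul_of_nonneg_right (mul_le_of_le_one_right hc'.le ?_) (sq_nonneg _)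
    refine Real.exp_le_one_iff.2 ?_
    have := mul_nonneg (mul_nonneg hc.le (weight_nonneg d (2 * Real.pi * ζ))) ht
    linarith
  obtain ⟨dU, hdU, hF⟩ := exists_isXDeriv hmem
  refine ⟨dU, dU₀, hdU, hdU₀, ?_⟩
  set b := c / 5 * (1 + t) with hb
  have hb0 : 0 < b := by positivity
  set g : ℝ → ℝ := fun x => |x| ^ (2 * j) * Real.exp (-b * |x| ^ lowOrder d) with hg
  obtain ⟨hgi, hgI⟩ := integrable_abs_pow_mul_exp (2 * j) (lowOrder d) hq hb0
  have hgi' : Integrable fun ζ : ℝ => g (2 * Real.pi * ζ) :=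
    hgi.comp_mul_left' Real.two_pi_pos.ne'
  have hgI' : ∫ ζ : ℝ, g (2 * Real.pi * ζ) = (2 * Real.pi)⁻¹ * (b ^ r * I) := by
    rw [Measure.integral_comp_mul_left, hg, hgI, smul_eq_mul,
      abs_of_pos (inv_pos.2 Real.two_pi_pos), hr, hI]
    push_cast
    rfl
  have hd0i : Integrable fun ζ : ℝ => ‖(𝓕 dU₀ : StateL2) ζ‖ ^ 2 :=
    (Lp.memLp (𝓕 dU₀ : StateL2)).integrable_norm_pow two_ne_zero
  have hsq : ‖dU‖ ^ 2 ≤ C₁ * (1 + t) ^ r * B ^ 2 + C₂ * ((1 + t) ^ ℓ)⁻¹ * ‖dU₀‖ ^ 2 := by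
    rw [sq_norm_eq_integral_fourier dU, sq_norm_eq_integral_fourier dU₀]
    calc ∫ ζ, ‖(𝓕 dU : StateL2) ζ‖ ^ 2
        ≤ ∫ ζ, (c' * Real.exp (c / 5) * B ^ 2 * g (2 * Real.pi * ζ)
          + C₂ * ((1 + t) ^ ℓ)⁻¹ * ‖(𝓕 dU₀ : StateL2) ζ‖ ^ 2) := by
          refine integral_mono_ae
            ((Lp.memLp (𝓕 dU : StateL2)).integrable_norm_pow two_ne_zero)
            ((hgi'.const_mul _).add (hd0i.const_mul _)) ?_
          filter_upwards [hpt, hF, hF₀, norm_fourier_le_integral_norm hL1] with ζ h1 h2 h3 h4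
          rw [h2, h3, norm_smul, norm_smul, norm_derivSymbol, norm_derivSymbol, mul_pow, mul_pow]
          set ξ := 2 * Real.pi * ζ
          have e1 : (|ξ| ^ j) ^ 2 = |ξ| ^ (2 * j) := by rw [← pow_mul, mul_comm]
          have e2 : (|ξ| ^ (j + ℓ)) ^ 2 = |ξ| ^ (2 * j) * (ξ ^ 2) ^ ℓ := by
            rw [← sq_abs ξ]
            ring
          rw [e1, e2]
          have hg0 : 0 ≤ g ξ := by simp only [hg]; positivity
          -- Low frequencies use the sup bound on `𝓕 U₀` by the `L¹` norm; high frequencies absorb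
          -- `(ξ²) ^ ℓ` into the derivative of order `j + ℓ`.
          rcases le_total |ξ| 1 with hξ | hξ
          · calc |ξ| ^ (2 * j) * ‖(𝓕 (U t) : StateL2) ζ‖ ^ 2
                ≤ |ξ| ^ (2 * j) * (c' * (Real.exp (c / 5)
                  * Real.exp (-b * |ξ| ^ lowOrder d)) * B ^ 2) := by
                  refine mul_le_mul_of_nonneg_left (h1.trans ?_) (by positivity)
                  gcongr
                  exact exp_weight_le_of_abs_le_one hc d hξ ht
              _ = c' * Real.exp (c / 5) * B ^ 2 * g ξ := by simp only [hg]; ring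
              _ ≤ _ := le_add_of_nonneg_right (by positivity)
          · calc |ξ| ^ (2 * j) * ‖(𝓕 (U t) : StateL2) ζ‖ ^ 2
                ≤ |ξ| ^ (2 * j) * (c' * (K * ((1 + t) ^ ℓ)⁻¹ * (ξ ^ 2) ^ ℓ)
                  * ‖(𝓕 U₀ : StateL2) ζ‖ ^ 2) := by
                  refine mul_le_mul_of_nonneg_left (h1.trans ?_) (by positivity)
                  gcongr
                  exact hhigh d ξ t hξ ht
              _ = C₂ * ((1 + t) ^ ℓ)⁻¹ * (|ξ| ^ (2 * j) * (ξ ^ 2) ^ ℓ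
                  * ‖(𝓕 U₀ : StateL2) ζ‖ ^ 2) := by rw [hC₂]; ring
              _ ≤ _ := le_add_of_nonneg_left (by positivity)
      _ = _ := by
          rw [integral_add (hgi'.const_mul _) (hd0i.const_mul _), integral_const_mul,
            integral_const_mul, hgI', hb, Real.mul_rpow (by positivity) ht1.le, hC₁]
          ring
  have e1 : ((1 + t) ^ (-(2 * (j : ℝ) + 1) / (2 * lowOrder d))) ^ 2 = (1 + t) ^ r := by
    rw [← Real.rpow_natCast _ 2, ← Real.rpow_mul ht1.le, hr]
    congr 1
    push_cast
    field_simp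
  have e2 : ((1 + t) ^ (-(ℓ : ℝ) / 2)) ^ 2 = ((1 + t) ^ ℓ)⁻¹ := by
    rw [← Real.rpow_natCast _ 2, ← Real.rpow_mul ht1.le, ← Real.rpow_natCast _ ℓ,
      ← Real.rpow_neg ht1.le]
    congr 1
    push_cast
    ring
  set p₁ := (1 + t) ^ (-(2 * (j : ℝ) + 1) / (2 * lowOrder d)) with hp₁
  set p₂ := (1 + t) ^ (-(ℓ : ℝ) / 2) with hp₂
  have hp₁0 : 0 ≤ p₁ := by positivity
  have hp₂0 : 0 ≤ p₂ := by positivity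
  have hle : ‖dU‖ ≤ √C₁ * p₁ * B + √C₂ * p₂ * ‖dU₀‖ := by
    refine le_of_abs_le (abs_le_of_sq_le_sq (hsq.trans ?_) (by positivity))
    rw [← e1, ← e2]
    have s1 := Real.sq_sqrt hC₁0.le
    have s2 := Real.sq_sqrt hC₂0.le
    have hx : 0 ≤ (√C₁ * p₁ * B) * (√C₂ * p₂ * ‖dU₀‖) := by positivity
    calc C₁ * p₁ ^ 2 * B ^ 2 + C₂ * p₂ ^ 2 * ‖dU₀‖ ^ 2
        = (√C₁ * p₁ * B) ^ 2 + (√C₂ * p₂ * ‖dU₀‖) ^ 2 := by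
          rw [mul_pow, mul_pow, mul_pow, mul_pow, s1, s2]
      _ ≤ _ := by nlinarith
  refine hle.trans (add_le_add ?_ ?_)
  · gcongr
    exact le_add_of_nonneg_right (Real.sqrt_nonneg _)
  · gcongr
    exact le_add_of_nonneg_left (Real.sqrt_nonneg _)

end Main

end LaminatedBeam

end

theorem mainTheorem1 (k₁ k₂ k₃ k₄ k₅ γ : ℝ)
    (hk₁ : 0 < k₁) (hk₂ : 0 < k₂) (hk₃ : 0 < k₃) (hk₄ : 0 < k₄) (hk₅ : 0 < k₅)
    (hγ : γ ≠ 0) (hχ : k₃ - k₂ ≠ 0) :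
    -- the pointwise bound in Fourier space, for both systems
    (∀ d : LaminatedBeam.HeatDissipation,
      ∃ c : ℝ, 0 < c ∧ ∃ c' : ℝ, 0 < c' ∧
        ∀ (ξ : ℝ) (V : ℝ → LaminatedBeam.State),
          LaminatedBeam.IsFourierSolution
            (LaminatedBeam.transversal k₁ k₂ k₃ k₄ k₅ γ) d ξ V →
          ∀ t : ℝ, 0 ≤ t →
            ‖V t‖ ^ 2 ≤ c' * Real.exp (-c * LaminatedBeam.weight d ξ * t) * ‖V 0‖ ^ 2) ∧
    -- the decay estimate for the system with the dissipation `-k₅ q_{xxt}`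
    (∀ N ℓ j : ℕ, 1 ≤ ℓ → ℓ ≤ N → j ≤ N - ℓ →
      ∃ c₀ : ℝ, 0 < c₀ ∧
        ∀ U₀ : LaminatedBeam.StateL2,
          TemperedDistribution.MemSobolev (N : ℝ) 2 (U₀ : 𝓢'(ℝ, LaminatedBeam.State)) →
          Integrable U₀ (volume : Measure ℝ) →
          ∀ U : ℝ → LaminatedBeam.StateL2,
            LaminatedBeam.IsSolution
              (LaminatedBeam.transversal k₁ k₂ k₃ k₄ k₅ γ) .strong U₀ U →
            ∀ t : ℝ, 0 ≤ t →
              ∃ dU dU₀ : LaminatedBeam.StateL2,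
                LaminatedBeam.IsXDeriv j (U t) dU ∧
                LaminatedBeam.IsXDeriv (j + ℓ) U₀ dU₀ ∧
                ‖dU‖ ≤ c₀ * (1 + t) ^ (-(1 / 12 : ℝ) - (j : ℝ) / 6) * (∫ x : ℝ, ‖U₀ x‖)
                  + c₀ * (1 + t) ^ (-(ℓ : ℝ) / 2) * ‖dU₀‖) ∧
    -- the decay estimate for the system with the dissipation `k₅ q_t`
    (∀ N ℓ j : ℕ, 1 ≤ ℓ → ℓ ≤ N → j ≤ N - ℓ →
      ∃ c₀ : ℝ, 0 < c₀ ∧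
        ∀ U₀ : LaminatedBeam.StateL2,
          TemperedDistribution.MemSobolev (N : ℝ) 2 (U₀ : 𝓢'(ℝ, LaminatedBeam.State)) →
          Integrable U₀ (volume : Measure ℝ) →
          ∀ U : ℝ → LaminatedBeam.StateL2,
            LaminatedBeam.IsSolution
              (LaminatedBeam.transversal k₁ k₂ k₃ k₄ k₅ γ) .weak U₀ U →
            ∀ t : ℝ, 0 ≤ t →
              ∃ dU dU₀ : LaminatedBeam.StateL2,
                LaminatedBeam.IsXDeriv j (U t) dU ∧
                LaminatedBeam.IsXDeriv (j + ℓ) U₀ dU₀ ∧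
                ‖dU‖ ≤ c₀ * (1 + t) ^ (-(1 / 8 : ℝ) - (j : ℝ) / 4) * (∫ x : ℝ, ‖U₀ x‖)
                  + c₀ * (1 + t) ^ (-(ℓ : ℝ) / 2) * ‖dU₀‖) := by
  refine ⟨fun d => LaminatedBeam.fourier_decay hk₁ hk₂ hk₃ hk₄ hk₅ hγ hχ d, fun N ℓ j _ hℓ hj => ?_,
    fun N ℓ j _ hℓ hj => ?_⟩
  · have h := LaminatedBeam.solution_decay hk₁ hk₂ hk₃ hk₄ hk₅ hγ hχ .strong N ℓ j (by omega)
    rwa [show -(2 * (j : ℝ) + 1) / (2 * LaminatedBeam.lowOrder .strong)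
      = -(1 / 12 : ℝ) - (j : ℝ) / 6 by simp only [LaminatedBeam.lowOrder]; push_cast; ring] at h
  · have h := LaminatedBeam.solution_decay hk₁ hk₂ hk₃ hk₄ hk₅ hγ hχ .weak N ℓ j (by omega)
    rwa [show -(2 * (j : ℝ) + 1) / (2 * LaminatedBeam.lowOrder .weak)
      = -(1 / 8 : ℝ) - (j : ℝ) / 4 by simp only [LaminatedBeam.lowOrder]; push_cast; ring] at h
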